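/- Let $d\ge 1$, let $\|\cdot\|$ and $\langle\cdot;\cdot\rangle$ be the Euclidean norm and inner product on $\mathbb R^d$, let $\mathbb S^{d-1}$ be the Euclidean unit sphere and $\mathcal S(\mathbb R^d)$ the space of real-valued Schwartz functions. A Lévy measure is a positive Borel measure $\nu$ on $\mathbb R^d$ with $\nu(\{0\})=0$ and $\int(1\wedge\|u\|^2)\,\nu(du)<+\infty$. A random vector is self-decomposable with parameter $b\in\mathbb R^d$, $\Sigma=0$ and Lévy measure $\nu$ if its characteristic function is $$\varphi(\xi)=\exp\Big(i\langle b;\xi\rangle+\int_{\mathbb R^d}\big(e^{i\langle\xi;u\rangle}-1-i\langle\xi;u\rangle\mathbf 1_{\|u\|\le 1}\big)\nu(du)\Big),\quad \xi\in\mathbb R^d,$$ and $\nu$ has a polar decomposition $\nu(du)=\mathbf 1_{(0,+\infty)}(r)\mathbf 1_{\mathbb S^{d-1}}(x)\frac{k_x(r)}{r}\,dr\,\sigma(dx)$ (with $u=rx$), where $\sigma$ is a finite positive measure on $\mathbb S^{d-1}$ and $k_x(r)$ is nonnegative, decreasing (in the wide sense) and right-continuous in $r>0$, and measurable in $x$.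 **Theorem.** Let $X$ be a random vector in $\mathbb R^d$, let $b\in\mathbb R^d$ and let $\nu$ be a Lévy measure on $\mathbb R^d$ with polar decomposition $$\nu(du)=\mathbf 1_{(0,+\infty)}(r)\mathbf 1_{\mathbb S^{d-1}}(x)\frac{k_x(r)}{r}\,dr\,\sigma(dx),$$ where $\sigma$ is a finite positive measure on $\mathbb S^{d-1}$ and where $k_x(r)$ is a nonnegative function, continuous and decreasing in $r\in(0,+\infty)$, continuous in $x\in\mathbb S^{d-1}$, and such that $$\lim_{\varepsilon\to0^+}\varepsilon k_x(\varepsilon)=k_x(1),\qquad \lim_{R\to+\infty}k_x(R)=0,\qquad x\in\mathbb S^{d-1},$$ $$\int_0^{+\infty}(1\wedge r^2)\max_{x\in\mathbb S^{d-1}}k_x(r)\,\frac{dr}{r}<+\infty.$$ Write $V_a^R(g)$ for the total variation of $g$ over $[a,R]$, and assume that, for every sequence $(x_n)_{n\ge1}$ in $\mathbb S^{d-1}$ converging to some $x\in\mathbb S^{d-1}$, $$\lim_{n\to+\infty}\lim_{R\to+\infty}V_a^R(k_{x_n}-k_x)=0,\qquad a>0.$$ Let $\tilde\nu$ be the positive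 measure on $\mathbb R^d$ defined in polar coordinates by $$\tilde\nu(du)=\mathbf 1_{(0,+\infty)}(r)\mathbf 1_{\mathbb S^{d-1}}(x)\,(-dk_x(r))\,\sigma(dx),$$ where $-dk_x$ is the Lebesgue–Stieltjes measure on $(0,+\infty)$ with $(-dk_x)((a,c])=k_x(a)-k_x(c)$ for $0<a\le c$, and assume that $\int_{\mathbb R^d}(1\wedge\|u\|^2)\,\tilde\nu(du)<+\infty$. Then $$\mathbb E\langle X;\nabla f(X)\rangle=\mathbb E\langle b;\nabla f(X)\rangle-\mathbb E\int_{\mathbb S^{d-1}}\langle\nabla f(X);x\rangle\,k_x(1)\,\sigma(dx)+\mathbb E\int_{\mathbb R^d}\big(f(X+u)-f(X)-\langle\nabla f(X);u\rangle\mathbf 1_{\|u\|\le1}\big)\,\tilde\nu(du)$$ for all $f\in\mathcal S(\mathbb R^d)$ if and only if $X$ is self-decomposable with parameter $b$, $\Sigma=0$ and Lévy measure $\nu$. -/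

import Mathlib

open MeasureTheory Set Filter Topology
open scoped ENNReal SchwartzMap

namespace SDStein

/-- The Euclidean space `ℝ^d`. -/
abbrev E (d : ℕ) := EuclideanSpace ℝ (Fin d)

/-- The Euclidean unit sphere `S^{d-1}` of `ℝ^d`. -/
abbrev Sph (d : ℕ) := Metric.sphere (0 : E d) 1

/-- A Lévy measure: `ν({0}) = 0` and `∫ (1 ∧ ‖u‖²) ν(du) < ∞`. -/
def IsLevyMeasure {d : ℕ} (ν : Measure (E d)) : Prop :=
  ν {0} = 0 ∧ ∫⁻ u, ENNReal.ofReal (min 1 (‖u‖ ^ 2)) ∂ν < ∞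

/-- The Lévy–Khintchine exponent
`i⟨b,ξ⟩ - ½⟨ξ,Σξ⟩ + ∫ (e^{i⟨ξ,u⟩} - 1 - i⟨ξ,u⟩ 1_{‖u‖ ≤ 1}) ν(du)`. -/
noncomputable def levyExponent {d : ℕ} (b : E d) (S : Matrix (Fin d) (Fin d) ℝ)
    (ν : Measure (E d)) (ξ : E d) : ℂ :=
  Complex.I * ((inner ℝ b ξ : ℝ) : ℂ)
    - ((1 / 2 * inner ℝ ξ (Matrix.toEuclideanLin S ξ) : ℝ) : ℂ)
    + ∫ u, (Complex.exp (Complex.I * ((inner ℝ ξ u : ℝ) : ℂ)) - 1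
        - if ‖u‖ ≤ 1 then Complex.I * ((inner ℝ ξ u : ℝ) : ℂ) else 0) ∂ν

/-- `μ` is infinitely divisible with generating triplet `(b, Σ, ν)`. -/
structure IsInfDivWithTriplet {d : ℕ} (μ : Measure (E d)) (b : E d)
    (S : Matrix (Fin d) (Fin d) ℝ) (ν : Measure (E d)) : Prop where
  posSemidef : S.PosSemidef
  levy : IsLevyMeasure ν
  charFun_eq : ∀ ξ : E d, charFun μ ξ = Complex.exp (levyExponent b S ν ξ)

/-- The measure `1_{(0,∞)}(r) 1_{S^{d-1}}(x) ρ_x(dr) σ(dx)` on `ℝ^d`, written in polar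
coordinates `u = r x`: each `ρ_x` is pushed to the ray spanned by `x`, then mixed over `σ`. -/
noncomputable def polarMeasure {d : ℕ} (σ : Measure (Sph d)) (ρ : Sph d → Measure ℝ) :
    Measure (E d) :=
  σ.bind fun x => (ρ x).map fun r : ℝ => r • (x : E d)

/-- The measure `1_{(0,∞)}(r) (k(r) / r) dr` on the line. -/
noncomputable def radialMeasure (k : ℝ → ℝ) : Measure ℝ :=
  (volume.restrict (Ioi 0)).withDensity fun r => ENNReal.ofReal (k r / r)

/-- In the variable `t = log r`, minus a decreasing function on `(0,∞)` is increasing on `ℝ`. -/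
theorem monotone_neg_comp_exp {k : ℝ → ℝ} (hk : AntitoneOn k (Ioi 0)) :
    Monotone fun t : ℝ => -k (Real.exp t) := fun _ _ hst =>
  neg_le_neg (hk (Real.exp_pos _) (Real.exp_pos _) (Real.exp_le_exp.mpr hst))

/-- The Lebesgue–Stieltjes measure `1_{(0,∞)}(r) (-dk(r))` of a decreasing function `k` on `(0,∞)`,
as a measure on the line: the Stieltjes measure of `t ↦ -k(e^t)` on `ℝ`, pushed forward by `exp`
(`k` may be unbounded near `0`, so `k` itself has no Stieltjes extension to `ℝ`). -/
noncomputable def negDiff (k : ℝ → ℝ) (hk : AntitoneOn k (Ioi 0)) : Measure ℝ :=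
  (monotone_neg_comp_exp hk).stieltjesFunction.measure.map Real.exp

/-- `negDiff` gives mass `k(a) - k(c)` to `(a, c]`, for right-continuous `k`. -/
theorem negDiff_Ioc {k : ℝ → ℝ} (hk : AntitoneOn k (Ioi 0))
    (hc : ∀ r, 0 < r → ContinuousWithinAt k (Ici r) r) {a c : ℝ} (ha : 0 < a) (hac : a ≤ c) :
    negDiff k hk (Ioc a c) = ENNReal.ofReal (k a - k c) := by
  have hm := monotone_neg_comp_exp hk
  have hval : ∀ r, 0 < r → hm.stieltjesFunction (Real.log r) = -k r := by
    intro r hr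
    rw [hm.stieltjesFunction_eq]
    have h1 : ContinuousWithinAt (fun t : ℝ => -k (Real.exp t)) (Ici (Real.log r))
        (Real.log r) := by
      refine ContinuousWithinAt.neg ?_
      have h2 : ContinuousWithinAt k (Ici r) (Real.exp (Real.log r)) := by
        rw [Real.exp_log hr]; exact hc r hr
      refine h2.comp Real.continuous_exp.continuousWithinAt ?_
      intro t ht
      have := Real.exp_le_exp.mpr (mem_Ici.mp ht)
      rwa [Real.exp_log hr] at this
    rw [h1.rightLim_eq, Real.exp_log hr]
  have hpre : Real.exp ⁻¹' Ioc a c = Ioc (Real.log a) (Real.log c) := by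
    ext t
    simp only [mem_preimage, mem_Ioc]
    rw [Real.log_lt_iff_lt_exp ha, Real.le_log_iff_exp_le (ha.trans_le hac)]
  rw [negDiff, Measure.map_apply Real.measurable_exp measurableSet_Ioc, hpre,
    StieltjesFunction.measure_Ioc, hval a ha, hval c (ha.trans_le hac)]
  congr 1
  ring

/-- The law `μ` is self-decomposable with parameter `b`, no Gaussian part and Lévy measure `ν`:
it is infinitely divisible with triplet `(b, 0, ν)`, and `ν(du) = (k_x(r) / r) dr σ(dx)` in polar
coordinates, with `σ` finite and `k_x(r)` nonnegative, decreasing and right-continuous in `r > 0`,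
and measurable in `x`. -/
def IsSelfDecomposable {d : ℕ} (μ : Measure (E d)) (b : E d) (ν : Measure (E d)) : Prop :=
  IsInfDivWithTriplet μ b 0 ν ∧
    ∃ (σ : Measure (Sph d)) (k : Sph d → ℝ → ℝ), IsFiniteMeasure σ ∧
      (∀ x, ∀ r, 0 < r → 0 ≤ k x r) ∧
      (∀ x, AntitoneOn (k x) (Ioi 0)) ∧
      (∀ x, ∀ r, 0 < r → ContinuousWithinAt (k x) (Ici r) r) ∧
      (∀ r, 0 < r → Measurable fun x => k x r) ∧
      ν = polarMeasure σ fun x => radialMeasure (k x)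

end SDStein

/-! Let φ be the characteristic function of X, ψ the Lévy exponent of (b, 0, ν), m = ∫ k_x(1) x
σ(dx), and ψ̃ the exponent of (b - m, 0, ν̃). The right-hand side of the Stein identity is the
expectation of a generator which acts in Fourier variables as multiplication by ψ̃
(`levyGenerator_of_eq_synth`). The left-hand side is the derivative of E f(e^{-τ}X) at τ = 0, up to
sign. So the identity for all f amounts to the linear flow equation d/dτ φ(e^{-τ}ξ) = -φ(e^{-τ}ξ)
ψ̃(e^{-τ}ξ).

The polar form of ν enters through one change of variables. As k_x(r) is the mass of (r, ∞) under
-dk_x, the measure ν is the image of ν̃ ⊗ ds, s > 0, under (u, s) ↦ e^{-s}u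
(`polarMeasure_radialMeasure_eq_map`). Hence ψ(ξ) = ∫_0^∞ ψ̃(e^{-s}ξ) ds
(`levyExponent_eq_integral`); the drift -m accounts for the vectors that the contraction brings into
the unit ball, where the compensator acts. Consequently exp ψ solves the same flow equation. The
product φ e^{-ψ} is then constant along τ ↦ e^{-τ}ξ and tends to 1 as τ → ∞, so φ = exp ψ
(`complexStein_iff_charFun_eq`).

No moment of X is assumed, so φ need not be differentiable a priori. The derivative is put on the
test function, where ⟨∇f(x), x⟩ is bounded. The flow equation is first obtained in integrated form
against Schwartz functions, then pointwise by continuity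
(`charFun_sub_eq_integral_of_complexStein`), and only then differentiated. -/

namespace SDStein

/-! ### Estimates for the Lévy–Khintchine exponent. -/

/-- The integrand `e^{i⟨ξ,u⟩} - 1 - i⟨ξ,u⟩ 1_{‖u‖ ≤ 1}` of the Lévy–Khintchine exponent. -/
noncomputable def levyIntegrand {d : ℕ} (ξ u : E d) : ℂ :=
  Complex.exp (Complex.I * ((inner ℝ ξ u : ℝ) : ℂ)) - 1
    - if ‖u‖ ≤ 1 then Complex.I * ((inner ℝ ξ u : ℝ) : ℂ) else 0

theorem levyExponent_zero_eq {d : ℕ} (b : E d) (ν : Measure (E d)) (ξ : E d) :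
    levyExponent b 0 ν ξ = Complex.I * ((inner ℝ b ξ : ℝ) : ℂ) + ∫ u, levyIntegrand ξ u ∂ν := by
  simp [levyExponent, levyIntegrand]

theorem norm_exp_I_mul_sub_one_sub_le (s : ℝ) :
    ‖Complex.exp (Complex.I * s) - 1 - Complex.I * s‖ ≤ 2 * s ^ 2 := by
  have hn : ‖Complex.I * (s : ℂ)‖ = |s| := by simp
  rcases le_or_gt |s| 1 with h | h
  · have := Complex.norm_exp_sub_one_sub_id_le (x := Complex.I * s) (by rwa [hn])
    rw [hn, sq_abs] at this
    nlinarith [sq_nonneg s]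
  · have h1 : ‖Complex.exp (Complex.I * s) - 1‖ ≤ |s| := by
      simpa using Real.norm_exp_I_mul_ofReal_sub_one_le (x := s)
    have h2 := norm_sub_le (Complex.exp (Complex.I * s) - 1) (Complex.I * s)
    rw [hn] at h2
    have h3 : |s| * 1 ≤ |s| * |s| := by gcongr
    rw [abs_mul_abs_self] at h3
    nlinarith

theorem norm_exp_I_mul_sub_one_le_two (s : ℝ) :
    ‖Complex.exp (Complex.I * s) - 1‖ ≤ 2 := by
  refine (norm_sub_le _ _).trans ?_
  rw [mul_comm, Complex.norm_exp_ofReal_mul_I]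
  norm_num

/-- The bound splits into a function of ξ and a function of u, so it serves for integration in u
alone and, after multiplication by a Schwartz function of ξ, on the product space. -/
theorem norm_levyIntegrand_le {d : ℕ} (ξ u : E d) :
    ‖levyIntegrand ξ u‖ ≤ 2 * (1 + ‖ξ‖ ^ 2) * min 1 (‖u‖ ^ 2) := by
  unfold levyIntegrand
  split_ifs with h
  · rw [min_eq_right (pow_le_one₀ (norm_nonneg _) h)]
    refine (norm_exp_I_mul_sub_one_sub_le _).trans ?_
    have h1 : (inner ℝ ξ u : ℝ) ^ 2 ≤ ‖ξ‖ ^ 2 * ‖u‖ ^ 2 := by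
      rw [← mul_pow, ← sq_abs (inner ℝ ξ u : ℝ)]
      gcongr
      exact abs_real_inner_le_norm ξ u
    nlinarith [sq_nonneg ‖u‖]
  · rw [min_eq_left (one_le_pow₀ (not_le.mp h).le), sub_zero]
    refine (norm_exp_I_mul_sub_one_le_two _).trans ?_
    nlinarith [sq_nonneg ‖ξ‖]

theorem measurable_levyIntegrand_comp {d : ℕ} {α : Type*} [MeasurableSpace α] {f g : α → E d}
    (hf : Measurable f) (hg : Measurable g) : Measurable fun a => levyIntegrand (f a) (g a) := by
  unfold levyIntegrand
  refine Measurable.sub (by fun_prop) (Measurable.ite ?_ (by fun_prop) measurable_const)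
  exact measurableSet_le (by fun_prop) measurable_const

theorem continuous_levyIntegrand {d : ℕ} (u : E d) :
    Continuous fun ξ : E d => levyIntegrand ξ u := by
  unfold levyIntegrand
  split_ifs <;> fun_prop

/-- `ν` integrates `u ↦ 1 ∧ ‖u‖²`. -/
theorem integrable_min_one_sq {d : ℕ} {ν : Measure (E d)}
    (hν : ∫⁻ u, ENNReal.ofReal (min 1 (‖u‖ ^ 2)) ∂ν < ∞) :
    Integrable (fun u => min 1 (‖u‖ ^ 2)) ν := by
  refine ⟨by fun_prop, ?_⟩
  rw [hasFiniteIntegral_iff_ofReal (Eventually.of_forall fun u => by positivity)]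
  exact hν

/-- The weight 1 ∧ ‖u‖² makes ν finite and vanishes only at 0, which is ν-null; dividing the finite
measure by the weight gives ν back. This is what permits Fubini with ν̃. -/
theorem sFinite_of_integrable_min_one_sq {d : ℕ} {ν : Measure (E d)} (h0 : ν {0} = 0)
    (hν : ∫⁻ u, ENNReal.ofReal (min 1 (‖u‖ ^ 2)) ∂ν < ∞) : SFinite ν := by
  have hm : Measurable fun u : E d => ENNReal.ofReal (min 1 (‖u‖ ^ 2)) := by fun_prop
  have : IsFiniteMeasure (ν.withDensity fun u => ENNReal.ofReal (min 1 (‖u‖ ^ 2))) :=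
    isFiniteMeasure_withDensity hν.ne
  have hne : ∀ᵐ u ∂ν, ENNReal.ofReal (min 1 (‖u‖ ^ 2)) ≠ 0 := by
    have : ∀ᵐ u ∂ν, u ≠ 0 := by
      rw [ae_iff]; simpa using h0
    filter_upwards [this] with u hu
    rw [← pos_iff_ne_zero, ENNReal.ofReal_pos]
    have := norm_pos_iff.mpr hu
    positivity
  rw [← withDensity_inv_same hm hne (Eventually.of_forall fun _ => ENNReal.ofReal_ne_top)]
  infer_instance

theorem integrable_levyIntegrand {d : ℕ} {ν : Measure (E d)}
    (hν : ∫⁻ u, ENNReal.ofReal (min 1 (‖u‖ ^ 2)) ∂ν < ∞) (ξ : E d) :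
    Integrable (levyIntegrand ξ) ν :=
  ((integrable_min_one_sq hν).const_mul _).mono'
    (measurable_levyIntegrand_comp measurable_const measurable_id).aestronglyMeasurable
    (Eventually.of_forall (norm_levyIntegrand_le ξ))

theorem continuous_levyExponent {d : ℕ} {ν : Measure (E d)}
    (hν : ∫⁻ u, ENNReal.ofReal (min 1 (‖u‖ ^ 2)) ∂ν < ∞) (b : E d) :
    Continuous (levyExponent b 0 ν) := by
  simp_rw [funext (levyExponent_zero_eq b ν)]
  refine Continuous.add (by fun_prop) (continuous_iff_continuousAt.mpr fun ξ₀ => ?_)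
  refine continuousAt_of_dominated
    (bound := fun u => 2 * (1 + (‖ξ₀‖ + 1) ^ 2) * min 1 (‖u‖ ^ 2)) ?_ ?_ ?_ ?_
  · exact Eventually.of_forall fun ξ => (integrable_levyIntegrand hν ξ).aestronglyMeasurable
  · filter_upwards [Metric.ball_mem_nhds ξ₀ one_pos] with ξ hξ
    refine Eventually.of_forall fun u => (norm_levyIntegrand_le ξ u).trans ?_
    have h1 : ‖ξ‖ ≤ ‖ξ₀‖ + 1 := by
      have := norm_le_norm_add_norm_sub' ξ ξ₀
      rw [mem_ball_iff_norm] at hξ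
      linarith
    gcongr
  · exact (integrable_min_one_sq hν).const_mul _
  · exact Eventually.of_forall fun u => (continuous_levyIntegrand u).continuousAt

theorem exists_norm_levyExponent_le {d : ℕ} {ν : Measure (E d)}
    (hν : ∫⁻ u, ENNReal.ofReal (min 1 (‖u‖ ^ 2)) ∂ν < ∞) (b : E d) :
    ∃ C, 0 ≤ C ∧ ∀ ξ, ‖levyExponent b 0 ν ξ‖ ≤ C * (1 + ‖ξ‖ ^ 2) := by
  have h0 : 0 ≤ ∫ u, min 1 (‖u‖ ^ 2) ∂ν := integral_nonneg fun u => by positivity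
  refine ⟨‖b‖ + 2 * ∫ u, min 1 (‖u‖ ^ 2) ∂ν, by positivity, fun ξ => ?_⟩
  rw [levyExponent_zero_eq]
  have h1 : ‖∫ u, levyIntegrand ξ u ∂ν‖ ≤ 2 * (1 + ‖ξ‖ ^ 2) * ∫ u, min 1 (‖u‖ ^ 2) ∂ν := by
    rw [← integral_const_mul]
    exact norm_integral_le_of_norm_le ((integrable_min_one_sq hν).const_mul _)
      (Eventually.of_forall (norm_levyIntegrand_le ξ))
  have h2 : ‖Complex.I * ((inner ℝ b ξ : ℝ) : ℂ)‖ ≤ ‖b‖ * (1 + ‖ξ‖ ^ 2) := by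
    rw [norm_mul, Complex.norm_I, one_mul, Complex.norm_real]
    refine (norm_inner_le_norm b ξ).trans ?_
    gcongr
    nlinarith [sq_nonneg (‖ξ‖ - 1)]
  refine (norm_add_le _ _).trans ((add_le_add h2 h1).trans (le_of_eq (by ring)))

@[simp]
theorem levyExponent_zero_right {d : ℕ} (b : E d) (ν : Measure (E d)) :
    levyExponent b 0 ν 0 = 0 := by
  simp [levyExponent]

/-! ### Polar measures and the contraction (u, s) ↦ e^{-s}u. -/

open ProbabilityTheory

theorem stieltjesFunction_neg_comp_exp {k : ℝ → ℝ} (hk : AntitoneOn k (Ioi 0))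
    (hc : ContinuousOn k (Ioi 0)) (t : ℝ) :
    (monotone_neg_comp_exp hk).stieltjesFunction t = -k (Real.exp t) := by
  rw [Monotone.stieltjesFunction_eq]
  have h : Continuous fun t : ℝ => -k (Real.exp t) :=
    (hc.comp_continuous Real.continuous_exp fun t => Real.exp_pos t).neg
  exact h.continuousWithinAt.rightLim_eq

/-- The pieces of the logarithmic Stieltjes measures on unit intervals form finite kernels. -/
theorem measurable_restrict_stieltjes {d : ℕ} {k : Sph d → ℝ → ℝ}
    (hk : ∀ x, AntitoneOn (k x) (Ioi 0)) (hc : ∀ x, ContinuousOn (k x) (Ioi 0))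
    (hs : ∀ r, 0 < r → Continuous fun x => k x r) (n : ℤ) :
    Measurable fun x => ((monotone_neg_comp_exp (hk x)).stieltjesFunction.measure).restrict
      (Ioc (n : ℝ) (n + 1)) := by
  have hIoc : ∀ a c : ℝ, Measurable fun x =>
      (monotone_neg_comp_exp (hk x)).stieltjesFunction.measure (Ioc a c) := by
    intro a c
    simp_rw [StieltjesFunction.measure_Ioc, stieltjesFunction_neg_comp_exp (hk _) (hc _)]
    have h1 := (hs _ (Real.exp_pos a)).measurable
    have h2 := (hs _ (Real.exp_pos c)).measurable
    fun_prop
  have hfin : ∀ x, IsFiniteMeasure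
      (((monotone_neg_comp_exp (hk x)).stieltjesFunction.measure).restrict
        (Ioc (n : ℝ) (n + 1))) := fun x =>
    ⟨by rw [Measure.restrict_apply_univ, StieltjesFunction.measure_Ioc]
        exact ENNReal.ofReal_lt_top⟩
  refine Measurable.measure_of_isPiSystem
    (BorelSpace.measurable_eq.trans (borel_eq_generateFrom_Iic ℝ)) isPiSystem_Iic ?_ ?_
  · rintro _ ⟨a, rfl⟩
    have : Iic a ∩ Ioc (n : ℝ) (n + 1) = Ioc (n : ℝ) ((n + 1) ⊓ a) := by
      rw [inter_comm, Ioc_inter_Iic]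
    simp_rw [Measure.restrict_apply measurableSet_Iic, this]
    exact hIoc _ _
  · simp_rw [Measure.restrict_apply_univ]
    exact hIoc _ _

/-- The measures `-dk_x` form an s-finite kernel when `k` is continuous in each variable. -/
theorem exists_kernel_negDiff {d : ℕ} {k : Sph d → ℝ → ℝ}
    (hk : ∀ x, AntitoneOn (k x) (Ioi 0)) (hc : ∀ x, ContinuousOn (k x) (Ioi 0))
    (hs : ∀ r, 0 < r → Continuous fun x => k x r) :
    ∃ κ : Kernel (Sph d) ℝ, IsSFiniteKernel κ ∧ ∀ x, κ x = negDiff (k x) (hk x) := by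
  -- The mass of -dk_x may be infinite near r = 0. It is cut along unit intervals of log r, and the
  -- mass of each piece is bounded uniformly in x by compactness of the sphere.
  let κn : ℤ → Kernel (Sph d) ℝ := fun n => ⟨_, measurable_restrict_stieltjes hk hc hs n⟩
  have hfin : ∀ n, IsFiniteKernel (κn n) := by
    intro n
    have hcont : Continuous fun x =>
        k x (Real.exp n) - k x (Real.exp (n + 1)) := by
      have h1 := hs _ (Real.exp_pos n)
      have h2 := hs _ (Real.exp_pos (n + 1))
      fun_prop
    obtain ⟨C, hC⟩ := isCompact_univ.exists_bound_of_continuousOn hcont.continuousOn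
    refine ⟨⟨ENNReal.ofReal C, ENNReal.ofReal_lt_top, fun x => ?_⟩⟩
    change ((monotone_neg_comp_exp (hk x)).stieltjesFunction.measure).restrict
      (Ioc (n : ℝ) (n + 1)) univ ≤ _
    rw [Measure.restrict_apply_univ, StieltjesFunction.measure_Ioc,
      stieltjesFunction_neg_comp_exp (hk _) (hc _), stieltjesFunction_neg_comp_exp (hk _) (hc _)]
    refine ENNReal.ofReal_le_ofReal ((le_of_eq (by ring)).trans
      ((le_abs_self _).trans (hC x (mem_univ x))))
  refine ⟨(Kernel.sum κn).map Real.exp, inferInstance, fun x => ?_⟩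
  rw [Kernel.map_apply _ Real.measurable_exp, Kernel.sum_apply, negDiff]
  congr 1
  change Measure.sum (fun n : ℤ =>
    ((monotone_neg_comp_exp (hk x)).stieltjesFunction.measure).restrict (Ioc (n : ℝ) (n + 1))) = _
  rw [← Measure.restrict_iUnion (pairwise_disjoint_Ioc_intCast ℝ) fun _ => measurableSet_Ioc,
    iUnion_Ioc_intCast, Measure.restrict_univ]

theorem measurable_smul_sph {d : ℕ} : Measurable fun p : Sph d × ℝ => p.2 • (p.1 : E d) := by
  fun_prop

/-- A polar measure built from an s-finite kernel is the image of the composition product. -/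
theorem polarMeasure_eq_map {d : ℕ} (σ : Measure (Sph d)) [SFinite σ] (κ : Kernel (Sph d) ℝ)
    [IsSFiniteKernel κ] :
    polarMeasure σ κ = (σ ⊗ₘ κ).map fun p => p.2 • (p.1 : E d) := by
  have hmeas : Measurable fun x => (κ x).map fun r : ℝ => r • (x : E d) := by
    refine Measure.measurable_measure.mpr fun s hs => ?_
    have : ∀ x : Sph d, ((κ x).map fun r : ℝ => r • (x : E d)) s
        = κ x (Prod.mk x ⁻¹' ((fun p : Sph d × ℝ => p.2 • (p.1 : E d)) ⁻¹' s)) := fun x => by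
      rw [Measure.map_apply (by fun_prop) hs]; rfl
    simp_rw [this]
    exact Kernel.measurable_kernel_prodMk_left (measurable_smul_sph hs)
  ext s hs
  rw [polarMeasure, Measure.bind_apply hs hmeas.aemeasurable,
    Measure.map_apply measurable_smul_sph hs, Measure.compProd_apply (measurable_smul_sph hs)]
  refine lintegral_congr fun x => ?_
  rw [Measure.map_apply (by fun_prop) hs]
  rfl

/-- In the variable y = log r the measure dr/r becomes Lebesgue measure and dilations become
translations. -/
theorem lintegral_radialMeasure {k : ℝ → ℝ} (hk : AntitoneOn k (Ioi 0)) {g : ℝ → ℝ≥0∞}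
    (hg : Measurable g) :
    ∫⁻ r, g r ∂radialMeasure k
      = ∫⁻ y, ENNReal.ofReal (k (Real.exp y)) * g (Real.exp y) := by
  have hm : AEMeasurable (fun r => ENNReal.ofReal (k r / r)) (volume.restrict (Ioi 0)) :=
    ((aemeasurable_restrict_of_antitoneOn measurableSet_Ioi hk).div
      measurable_id.aemeasurable).ennreal_ofReal
  rw [radialMeasure, lintegral_withDensity_eq_lintegral_mul₀ hm hg.aemeasurable,
    ← Real.range_exp, ← image_univ,
    lintegral_image_eq_lintegral_abs_deriv_mul MeasurableSet.univ
      (fun y _ => (Real.hasDerivAt_exp y).hasDerivWithinAt) Real.exp_injective.injOn,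
    setLIntegral_univ]
  refine lintegral_congr fun y => ?_
  rw [Pi.mul_apply, ← mul_assoc, abs_of_pos (Real.exp_pos y),
    ← ENNReal.ofReal_mul (Real.exp_pos y).le, mul_div_cancel₀ _ (Real.exp_pos y).ne']

/-- Decay of k at infinity enters here: without it the tail would only be k minus its limit. -/
theorem stieltjes_neg_comp_exp_Ioi {k : ℝ → ℝ} (hk : AntitoneOn k (Ioi 0))
    (hc : ContinuousOn k (Ioi 0)) (h0 : Tendsto k atTop (𝓝 0)) (y : ℝ) :
    (monotone_neg_comp_exp hk).stieltjesFunction.measure (Ioi y)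
      = ENNReal.ofReal (k (Real.exp y)) := by
  have h : Tendsto (monotone_neg_comp_exp hk).stieltjesFunction atTop (𝓝 0) := by
    rw [funext (stieltjesFunction_neg_comp_exp hk hc)]
    simpa using (h0.comp Real.tendsto_exp_atTop).neg
  rw [StieltjesFunction.measure_Ioi _ h, stieltjesFunction_neg_comp_exp hk hc]
  simp

instance {k : ℝ → ℝ} (hk : AntitoneOn k (Ioi 0)) : SFinite (negDiff k hk) := by
  unfold negDiff; infer_instance

/-- `(k(r)/r) dr` is the image of `-dk(r) ds`, `s > 0`, under `(r, s) ↦ e^{-s} r`. -/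
theorem radialMeasure_eq_map {k : ℝ → ℝ} (hk : AntitoneOn k (Ioi 0))
    (hc : ContinuousOn k (Ioi 0)) (h0 : Tendsto k atTop (𝓝 0)) :
    radialMeasure k = ((negDiff k hk).prod (volume.restrict (Ioi (0 : ℝ)))).map
      fun p => Real.exp (-p.2) * p.1 := by
  refine Measure.ext_of_lintegral _ fun g hg => ?_
  have hG : Measurable fun y => g (Real.exp y) := by fun_prop
  have hinner : ∀ z : ℝ, ∫⁻ s in Ioi (0 : ℝ), g (Real.exp (-s) * Real.exp z)
      = ∫⁻ y, (Iio z).indicator (fun y => g (Real.exp y)) y := by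
    intro z
    -- Substitution y = z - s, which maps s > 0 onto y < z.
    rw [← lintegral_sub_left_eq_self (μ := volume) ((Iio z).indicator _) z, ← lintegral_indicator measurableSet_Ioi]
    refine lintegral_congr fun s => ?_
    by_cases hs : 0 < s
    · rw [indicator_of_mem (show s ∈ Ioi (0 : ℝ) from hs),
        indicator_of_mem (show z - s ∈ Iio z by simpa using hs), ← Real.exp_add]
      congr 2; ring
    · rw [indicator_of_notMem (show s ∉ Ioi (0 : ℝ) from hs),
        indicator_of_notMem (show z - s ∉ Iio z by simpa using hs)]
  rw [lintegral_radialMeasure hk hg, lintegral_map hg (by fun_prop),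
    lintegral_prod _ (by fun_prop), negDiff,
    lintegral_map (f := fun r => ∫⁻ s in Ioi (0 : ℝ), g (Real.exp (-s) * r))
      (Measurable.lintegral_prod_right' (f := fun p : ℝ × ℝ => g (Real.exp (-p.2) * p.1))
        (by fun_prop)) Real.measurable_exp]
  simp_rw [hinner]
  have hmeas : Measurable (Function.uncurry fun z y : ℝ =>
      (Iio z).indicator (fun y => g (Real.exp y)) y) := by
    have : MeasurableSet {p : ℝ × ℝ | p.2 < p.1} := measurableSet_lt (by fun_prop) (by fun_prop)
    convert (hG.comp measurable_snd).indicator this using 1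
    ext p
    simp [Function.uncurry, indicator_apply]
  -- By Tonelli, each y is weighted by the mass of z > y, which is k(e^y), the density of
  -- `radialMeasure` in logarithmic coordinates.
  rw [lintegral_lintegral_swap hmeas.aemeasurable]
  refine lintegral_congr fun y => ?_
  have : ∀ z, (Iio z).indicator (fun y => g (Real.exp y)) y
      = (Ioi y).indicator (fun _ => g (Real.exp y)) z := fun z => by
    by_cases h : y < z
    · rw [indicator_of_mem (show y ∈ Iio z from h), indicator_of_mem (show z ∈ Ioi y from h)]
    · rw [indicator_of_notMem (show y ∉ Iio z from h),
        indicator_of_notMem (show z ∉ Ioi y from h)]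
  simp_rw [this]
  rw [lintegral_indicator measurableSet_Ioi, setLIntegral_const,
    stieltjes_neg_comp_exp_Ioi hk hc h0, mul_comm]

/-- The polar measure of `(k_x(r)/r) dr` is the image of `ν̃ ⊗ ds`, `s > 0`, under
`(u, s) ↦ e^{-s} u`, where `ν̃` is the polar measure of `-dk_x(r)`. -/
theorem polarMeasure_radialMeasure_eq_map {d : ℕ} (σ : Measure (Sph d)) [SFinite σ]
    {k : Sph d → ℝ → ℝ} (hk : ∀ x, AntitoneOn (k x) (Ioi 0))
    (hc : ∀ x, ContinuousOn (k x) (Ioi 0)) (hs : ∀ r, 0 < r → Continuous fun x => k x r)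
    (h0 : ∀ x, Tendsto (k x) atTop (𝓝 0)) :
    (polarMeasure σ fun x => radialMeasure (k x))
      = ((polarMeasure σ fun x => negDiff (k x) (hk x)).prod
          (volume.restrict (Ioi (0 : ℝ)))).map fun p => Real.exp (-p.2) • p.1 := by
  obtain ⟨κ, hκ, hκe⟩ := exists_kernel_negDiff hk hc hs
  have hmul : Measurable fun p : ℝ × ℝ => Real.exp (-p.2) * p.1 := by fun_prop
  let η : Kernel (Sph d) ℝ :=
    (κ ×ₖ Kernel.const (Sph d) (volume.restrict (Ioi (0 : ℝ)))).map
      fun p => Real.exp (-p.2) * p.1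
  have hη : (fun x => radialMeasure (k x)) = η := by
    ext1 x
    rw [radialMeasure_eq_map (hk x) (hc x) (h0 x), Kernel.map_apply _ hmul, Kernel.prod_apply,
      Kernel.const_apply, hκe]
  rw [← funext hκe, hη, polarMeasure_eq_map, polarMeasure_eq_map]
  refine Measure.ext_of_lintegral _ fun g hg => ?_
  have hJ : Measurable fun u : E d => ∫⁻ s in Ioi (0 : ℝ), g (Real.exp (-s) • u) :=
    Measurable.lintegral_prod_right' (f := fun p : E d × ℝ => g (Real.exp (-p.2) • p.1))
      (by fun_prop)
  rw [lintegral_map hg (by fun_prop), lintegral_map hg (by fun_prop),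
    lintegral_prod _ (by fun_prop), lintegral_map hJ (by fun_prop),
    Measure.lintegral_compProd (by fun_prop),
    Measure.lintegral_compProd (f := fun p : Sph d × ℝ =>
      ∫⁻ s in Ioi (0 : ℝ), g (Real.exp (-s) • p.2 • (p.1 : E d))) (hJ.comp measurable_smul_sph)]
  refine lintegral_congr fun x => ?_
  rw [Kernel.map_apply _ hmul, Kernel.prod_apply, Kernel.const_apply,
    lintegral_map (by fun_prop) hmul, lintegral_prod _ (by fun_prop)]
  simp_rw [mul_smul]

theorem norm_sph {d : ℕ} (x : Sph d) : ‖(x : E d)‖ = 1 := norm_eq_of_mem_sphere x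

theorem negDiff_Iic_zero {k : ℝ → ℝ} (hk : AntitoneOn k (Ioi 0)) : negDiff k hk (Iic 0) = 0 := by
  rw [negDiff, Measure.map_apply Real.measurable_exp measurableSet_Iic]
  convert measure_empty (μ := (monotone_neg_comp_exp hk).stieltjesFunction.measure)
  ext t
  simp [Real.exp_pos]

theorem negDiff_Ioi_one {k : ℝ → ℝ} (hk : AntitoneOn k (Ioi 0))
    (hc : ContinuousOn k (Ioi 0)) (h0 : Tendsto k atTop (𝓝 0)) :
    negDiff k hk (Ioi 1) = ENNReal.ofReal (k 1) := by
  rw [negDiff, Measure.map_apply Real.measurable_exp measurableSet_Ioi]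
  convert stieltjes_neg_comp_exp_Ioi hk hc h0 0 using 2
  · ext t; simp
  · simp

/-- Integrability of 1 ∧ ‖u‖² says nothing about an atom at 0; its absence has to be known
separately to get s-finiteness of ν̃. -/
theorem polarMeasure_negDiff_singleton_zero {d : ℕ} (σ : Measure (Sph d)) [SFinite σ]
    {k : Sph d → ℝ → ℝ} (hk : ∀ x, AntitoneOn (k x) (Ioi 0))
    (hc : ∀ x, ContinuousOn (k x) (Ioi 0)) (hs : ∀ r, 0 < r → Continuous fun x => k x r) :
    (polarMeasure σ fun x => negDiff (k x) (hk x)) {0} = 0 := by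
  obtain ⟨κ, hκ, hκe⟩ := exists_kernel_negDiff hk hc hs
  rw [← funext hκe, polarMeasure_eq_map, Measure.map_apply measurable_smul_sph (by simp),
    Measure.compProd_apply (measurable_smul_sph (by simp))]
  refine lintegral_eq_zero_of_ae_eq_zero (Eventually.of_forall fun x => ?_)
  refine measure_mono_null ?_ ((congrArg (· (Iic 0)) (hκe x)).trans (negDiff_Iic_zero (hk x)))
  intro r hr
  have hx : (x : E d) ≠ 0 := ne_zero_of_mem_unit_sphere x
  exact ((smul_eq_zero.mp (show r • (x : E d) = 0 from hr)).resolve_right hx).le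

/-- `∫_{‖u‖>1} u/‖u‖ ν̃(du) = ∫ k_x(1) x σ(dx)`, tested against a vector. -/
theorem integral_inner_normalize_polarMeasure_negDiff {d : ℕ} (σ : Measure (Sph d)) [SFinite σ]
    {k : Sph d → ℝ → ℝ} (hk : ∀ x, AntitoneOn (k x) (Ioi 0))
    (hc : ∀ x, ContinuousOn (k x) (Ioi 0)) (hs : ∀ r, 0 < r → Continuous fun x => k x r)
    (h0 : ∀ x, Tendsto (k x) atTop (𝓝 0)) (hnn : ∀ x, ∀ r, 0 < r → 0 ≤ k x r)
    (hint : ∫⁻ u, ENNReal.ofReal (min 1 (‖u‖ ^ 2))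
      ∂(polarMeasure σ fun x => negDiff (k x) (hk x)) < ∞) (ξ : E d) :
    ∫ u, (if 1 < ‖u‖ then inner ℝ ξ u / ‖u‖ else 0)
        ∂(polarMeasure σ fun x => negDiff (k x) (hk x))
      = ∫ x, inner ℝ ξ (x : E d) * k x 1 ∂σ := by
  have hI : Integrable (fun u : E d => if 1 < ‖u‖ then inner ℝ ξ u / ‖u‖ else 0)
      (polarMeasure σ fun x => negDiff (k x) (hk x)) := by
    refine ((integrable_min_one_sq hint).const_mul ‖ξ‖).mono' ?_ (Eventually.of_forall fun u => ?_)
    · exact (Measurable.ite (measurableSet_lt measurable_const (by fun_prop)) (by fun_prop)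
        measurable_const).aestronglyMeasurable
    · split_ifs with h
      · have hu : 0 < ‖u‖ := one_pos.trans h
        rw [min_eq_left (one_le_pow₀ h.le), mul_one, norm_div, norm_norm, div_le_iff₀ hu]
        exact norm_inner_le_norm ξ u
      · rw [norm_zero]; positivity
  obtain ⟨κ, hκ, hκe⟩ := exists_kernel_negDiff hk hc hs
  rw [← funext hκe, polarMeasure_eq_map] at hI ⊢
  rw [integral_map (by fun_prop) hI.aestronglyMeasurable,
    Measure.integral_compProd (f := fun p : Sph d × ℝ => if 1 < ‖p.2 • (p.1 : E d)‖ then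
      inner ℝ ξ (p.2 • (p.1 : E d)) / ‖p.2 • (p.1 : E d)‖ else 0)
      (hI.comp_measurable measurable_smul_sph)]
  refine integral_congr_ae (Eventually.of_forall fun x => ?_)
  have h1 : ∀ᵐ r ∂κ x, (if 1 < ‖r • (x : E d)‖ then inner ℝ ξ (r • (x : E d)) / ‖r • (x : E d)‖
      else 0) = (Ioi (1 : ℝ)).indicator (fun _ => inner ℝ ξ (x : E d)) r := by
    have : ∀ᵐ r ∂κ x, 0 < r := by
      rw [ae_iff, hκe]; simpa [Iic, not_lt] using negDiff_Iic_zero (hk x)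
    filter_upwards [this] with r hr
    have hn : ‖r • (x : E d)‖ = r := by
      rw [norm_smul, norm_sph, mul_one, Real.norm_of_nonneg hr.le]
    rw [hn, real_inner_smul_right, mul_div_cancel_left₀ _ hr.ne']
    simp [indicator_apply]
  change ∫ r, _ ∂κ x = _
  rw [integral_congr_ae h1, integral_indicator measurableSet_Ioi, setIntegral_const, hκe,
    measureReal_def, negDiff_Ioi_one (hk x) (hc x) (h0 x),
    ENNReal.toReal_ofReal (hnn x 1 one_pos), smul_eq_mul, mul_comm]

/-! ### The exponent of ν as an integral of the exponent of ν̃ along the flow. -/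

/-- The change of compensator between `ξ ↦ e^{-s} ξ` and `u ↦ e^{-s} u`. -/
noncomputable def compensatorShift {d : ℕ} (ξ : E d) (p : E d × ℝ) : ℝ :=
  if 1 < ‖p.1‖ ∧ ‖Real.exp (-p.2) • p.1‖ ≤ 1 then Real.exp (-p.2) * inner ℝ ξ p.1 else 0

theorem measurable_compensatorShift {d : ℕ} (ξ : E d) : Measurable (compensatorShift ξ) := by
  unfold compensatorShift
  have h1 : MeasurableSet {p : E d × ℝ | 1 < ‖p.1‖} :=
    measurableSet_lt measurable_const (by fun_prop)
  have h2 : MeasurableSet {p : E d × ℝ | ‖Real.exp (-p.2) • p.1‖ ≤ 1} :=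
    measurableSet_le (by fun_prop) measurable_const
  exact Measurable.ite (h1.inter h2) (by fun_prop) measurable_const

/-- Only the truncations differ. Since s > 0 contracts, they disagree exactly when u lies outside
the unit ball and e^{-s}u inside. -/
theorem levyIntegrand_smul_left {d : ℕ} (ξ u : E d) {s : ℝ} (hs : 0 < s) :
    levyIntegrand (Real.exp (-s) • ξ) u
      = levyIntegrand ξ (Real.exp (-s) • u) + Complex.I * (compensatorShift ξ (u, s) : ℂ) := by
  have hle : ‖u‖ ≤ 1 → ‖Real.exp (-s) • u‖ ≤ 1 := fun h => by
    rw [norm_smul, Real.norm_of_nonneg (Real.exp_pos _).le]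
    exact mul_le_one₀ (Real.exp_le_one_iff.mpr (by linarith)) (norm_nonneg _) h
  unfold levyIntegrand compensatorShift
  simp only [real_inner_smul_left, real_inner_smul_right]
  by_cases h1 : ‖u‖ ≤ 1
  · simp [h1, hle h1, not_lt.mpr h1]
  · by_cases h2 : ‖Real.exp (-s) • u‖ ≤ 1
    · simp [h1, h2, not_le.mp h1]
    · simp [h1, h2]

theorem compensatorShift_eq_indicator {d : ℕ} (ξ : E d) {u : E d} (hu : 1 < ‖u‖) (s : ℝ) :
    compensatorShift ξ (u, s)
      = (Ici (Real.log ‖u‖)).indicator (fun s => Real.exp (-s) * inner ℝ ξ u) s := by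
  have hu0 : 0 < ‖u‖ := one_pos.trans hu
  have : ‖Real.exp (-s) • u‖ ≤ 1 ↔ Real.log ‖u‖ ≤ s := by
    rw [norm_smul, Real.norm_of_nonneg (Real.exp_pos _).le, Real.exp_neg,
      inv_mul_le_iff₀ (Real.exp_pos _), mul_one, Real.log_le_iff_le_exp hu0]
  simp [compensatorShift, hu, this, indicator_apply]

theorem setIntegral_indicator_exp_neg_mul {a : ℝ} (ha : 0 < a) (c : ℝ) :
    ∫ s in Ioi (0 : ℝ), (Ici a).indicator (fun s => Real.exp (-s) * c) s
      = Real.exp (-a) * c := by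
  rw [setIntegral_indicator measurableSet_Ici,
    inter_eq_right.mpr (show Ici a ⊆ Ioi 0 from fun x hx => ha.trans_le hx),
    integral_Ici_eq_integral_Ioi, integral_mul_const, integral_exp_neg_Ioi]

/-- A vector with ‖u‖ > 1 enters the unit ball at time log ‖u‖, and ∫ e^{-s} ds from that time on is
1/‖u‖. Integrated over ν̃, this produces the drift m. -/
theorem integral_compensatorShift {d : ℕ} (ξ u : E d) :
    ∫ s in Ioi (0 : ℝ), compensatorShift ξ (u, s)
      = if 1 < ‖u‖ then inner ℝ ξ u / ‖u‖ else 0 := by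
  split_ifs with hu
  · simp_rw [compensatorShift_eq_indicator ξ hu]
    rw [setIntegral_indicator_exp_neg_mul (Real.log_pos hu), Real.exp_neg,
      Real.exp_log (one_pos.trans hu), div_eq_inv_mul]
  · simp [compensatorShift, hu]

theorem integral_norm_compensatorShift {d : ℕ} (ξ u : E d) :
    ∫ s in Ioi (0 : ℝ), ‖compensatorShift ξ (u, s)‖
      = if 1 < ‖u‖ then |inner ℝ ξ u| / ‖u‖ else 0 := by
  split_ifs with hu
  · have : ∀ s, ‖compensatorShift ξ (u, s)‖
        = (Ici (Real.log ‖u‖)).indicator (fun s => Real.exp (-s) * |inner ℝ ξ u|) s := fun s => by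
      rw [compensatorShift_eq_indicator ξ hu, norm_indicator_eq_indicator_norm]
      simp
    simp_rw [this]
    rw [setIntegral_indicator_exp_neg_mul (Real.log_pos hu), Real.exp_neg,
      Real.exp_log (one_pos.trans hu), div_eq_inv_mul]
  · simp [compensatorShift, hu]

theorem integrable_compensatorShift {d : ℕ} {νt : Measure (E d)} [SFinite νt]
    (hνt : ∫⁻ u, ENNReal.ofReal (min 1 (‖u‖ ^ 2)) ∂νt < ∞) (ξ : E d) :
    Integrable (compensatorShift ξ) (νt.prod (volume.restrict (Ioi (0 : ℝ)))) := by
  rw [integrable_prod_iff (measurable_compensatorShift ξ).aestronglyMeasurable]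
  refine ⟨Eventually.of_forall fun u => ?_, ?_⟩
  · by_cases hu : 1 < ‖u‖
    · simp_rw [compensatorShift_eq_indicator ξ hu]
      exact ((integrableOn_exp_neg_Ioi 0).mul_const _).indicator measurableSet_Ici
    · simp [compensatorShift, hu]
  · simp_rw [integral_norm_compensatorShift]
    refine ((integrable_min_one_sq hνt).const_mul ‖ξ‖).mono' ?_ (Eventually.of_forall fun u => ?_)
    · exact (Measurable.ite (measurableSet_lt measurable_const (by fun_prop)) (by fun_prop)
        measurable_const).aestronglyMeasurable
    · split_ifs with h
      · have hu : 0 < ‖u‖ := one_pos.trans h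
        rw [min_eq_left (one_le_pow₀ h.le), mul_one, norm_div, norm_norm, div_le_iff₀ hu,
          Real.norm_eq_abs, abs_abs]
        exact abs_real_inner_le_norm ξ u
      · rw [norm_zero]; positivity

/-- The exponent of a measure that is the image of `ν̃ ⊗ ds`, `s > 0`, under `(u, s) ↦ e^{-s} u`,
is the integral along the flow `ξ ↦ e^{-s} ξ` of the exponent of `ν̃` with shifted drift. -/
theorem levyExponent_eq_integral {d : ℕ} {ν νt : Measure (E d)} [SFinite νt]
    (hν : ∫⁻ u, ENNReal.ofReal (min 1 (‖u‖ ^ 2)) ∂ν < ∞)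
    (hνt : ∫⁻ u, ENNReal.ofReal (min 1 (‖u‖ ^ 2)) ∂νt < ∞)
    (hmap : ν = (νt.prod (volume.restrict (Ioi (0 : ℝ)))).map fun p => Real.exp (-p.2) • p.1)
    {m : E d} (hm : ∀ ξ, ∫ u, (if 1 < ‖u‖ then inner ℝ ξ u / ‖u‖ else 0) ∂νt = inner ℝ m ξ)
    (b ξ : E d) :
    IntegrableOn (fun s => levyExponent (b - m) 0 νt (Real.exp (-s) • ξ)) (Ioi 0) ∧
      levyExponent b 0 ν ξ
        = ∫ s in Ioi (0 : ℝ), levyExponent (b - m) 0 νt (Real.exp (-s) • ξ) := by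
  have hφ : Measurable fun p : E d × ℝ => Real.exp (-p.2) • p.1 := by fun_prop
  have hQ := integrable_levyIntegrand hν ξ
  rw [hmap] at hQ
  have hQe := integral_map hφ.aemeasurable hQ.aestronglyMeasurable
  rw [← hmap] at hQe
  have hQ' := hQ.comp_measurable hφ
  have hc := integrable_compensatorShift hνt ξ
  have hcI : Integrable (fun p => Complex.I * (compensatorShift ξ p : ℂ))
      (νt.prod (volume.restrict (Ioi (0 : ℝ)))) := hc.ofReal.const_mul _
  -- Fubini is applied to this sum because its section at fixed s is the integrand of ν̃ at e^{-s}ξ.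
  -- Its first term is integrable since ν is the image of the product measure.
  have hsum := hQ'.add hcI
  have hce : ∫ p, Complex.I * (compensatorShift ξ p : ℂ) ∂(νt.prod (volume.restrict (Ioi (0 : ℝ))))
      = Complex.I * (inner ℝ m ξ : ℝ) := by
    rw [integral_const_mul, integral_complex_ofReal, integral_prod _ hc]
    simp_rw [integral_compensatorShift]
    rw [hm]
  have hswap := integral_prod_symm _ hsum
  have hpt : ∀ s ∈ Ioi (0 : ℝ), ∫ u, (levyIntegrand ξ ∘ (fun p : E d × ℝ =>
      Real.exp (-p.2) • p.1) + fun p => Complex.I * (compensatorShift ξ p : ℂ)) (u, s) ∂νt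
      = ∫ u, levyIntegrand (Real.exp (-s) • ξ) u ∂νt := fun s hs =>
    integral_congr_ae (Eventually.of_forall fun u => (levyIntegrand_smul_left ξ u hs).symm)
  have hJ : IntegrableOn (fun s => ∫ u, levyIntegrand (Real.exp (-s) • ξ) u ∂νt) (Ioi 0) :=
    (integrableOn_congr_fun hpt measurableSet_Ioi).mp hsum.integral_prod_right
  have hlin : IntegrableOn (fun s => Complex.I * (inner ℝ (b - m) (Real.exp (-s) • ξ) : ℝ))
      (Ioi 0) := by
    simp_rw [real_inner_smul_right]
    exact (((integrableOn_exp_neg_Ioi 0).mul_const _).ofReal).const_mul _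
  -- As ∫_0^∞ e^{-s} ds = 1, the drift b - m survives unchanged; the compensator term then restores
  -- b.
  have hline : ∫ s in Ioi (0 : ℝ), Complex.I * ((inner ℝ (b - m) (Real.exp (-s) • ξ) : ℝ) : ℂ)
      = Complex.I * (inner ℝ (b - m) ξ : ℝ) := by
    simp_rw [real_inner_smul_right]
    rw [integral_const_mul, integral_complex_ofReal, integral_mul_const, integral_exp_neg_Ioi_zero,
      one_mul]
  simp_rw [levyExponent_zero_eq]
  refine ⟨hlin.add hJ, ?_⟩
  rw [integral_add hlin hJ, hline, ← setIntegral_congr_fun measurableSet_Ioi hpt, ← hswap]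
  rw [integral_add' hQ' hcI, hce, hQe, inner_sub_left]
  simp only [Function.comp_apply]
  push_cast
  ring

/-- Along the flow `ξ ↦ e^{-s} ξ` the exponent of `ν` has derivative minus the exponent of `ν̃`. -/
theorem hasDerivAt_of_eq_integral_exp_neg {d : ℕ} {ψ Φ : E d → ℂ} (hΦ : Continuous Φ)
    (hint : ∀ ξ, IntegrableOn (fun s => Φ (Real.exp (-s) • ξ)) (Ioi 0))
    (hψ : ∀ ξ, ψ ξ = ∫ s in Ioi (0 : ℝ), Φ (Real.exp (-s) • ξ)) (ξ : E d) (τ : ℝ) :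
    HasDerivAt (fun τ => ψ (Real.exp (-τ) • ξ)) (-Φ (Real.exp (-τ) • ξ)) τ := by
  have hcont : Continuous fun s => Φ (Real.exp (-s) • ξ) := by fun_prop
  have key : ∀ τ, ψ (Real.exp (-τ) • ξ) = ψ ξ - ∫ s in (0 : ℝ)..τ, Φ (Real.exp (-s) • ξ) := by
    intro τ
    have h1 : ∫ s in Ioi (0 : ℝ), Φ (Real.exp (-s) • Real.exp (-τ) • ξ)
        = ∫ s in Ioi τ, Φ (Real.exp (-s) • ξ) := by
      have := (measurePreserving_add_right volume τ).setIntegral_preimage_emb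
        (measurableEmbedding_addRight τ) (fun s => Φ (Real.exp (-s) • ξ)) (Ioi τ)
      rw [preimage_add_const_Ioi, sub_self] at this
      rw [← this]
      refine integral_congr_ae (Eventually.of_forall fun s => ?_)
      change Φ _ = Φ _
      rw [smul_smul, ← Real.exp_add, neg_add]
    -- The time τ may be negative; the extra interval (τ, 0] is bounded, so continuity suffices
    -- there.
    have h2 : IntegrableOn (fun s => Φ (Real.exp (-s) • ξ)) (Ioi τ) := by
      rcases le_total 0 τ with h | h
      · exact (hint ξ).mono_set (Ioi_subset_Ioi h)
      · rw [← Ioc_union_Ioi_eq_Ioi h]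
        exact (hcont.integrableOn_Ioc).union (hint ξ)
    rw [hψ, h1, hψ, eq_sub_iff_add_eq, add_comm,
      intervalIntegral.integral_interval_add_Ioi' (hcont.intervalIntegrable _ _) h2]
  rw [funext key]
  exact (intervalIntegral.integral_hasDerivAt_right (hcont.intervalIntegrable _ _)
    (hcont.stronglyMeasurableAtFilter _ _) hcont.continuousAt).const_sub _

/-! ### Superpositions of characters and the generator as a Fourier multiplier. -/

/-- The character `x ↦ e^{i⟨ξ,x⟩}`. -/
noncomputable def expInner {d : ℕ} (ξ x : E d) : ℂ :=
  Complex.exp (Complex.I * ((inner ℝ ξ x : ℝ) : ℂ))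

@[simp]
theorem norm_expInner {d : ℕ} (ξ x : E d) : ‖expInner ξ x‖ = 1 := by
  rw [expInner, mul_comm, Complex.norm_exp_ofReal_mul_I]

@[fun_prop]
theorem Continuous.expInner {d : ℕ} {α : Type*} [TopologicalSpace α] {f g : α → E d}
    (hf : Continuous f) (hg : Continuous g) : Continuous fun a => expInner (f a) (g a) := by
  unfold SDStein.expInner; fun_prop

theorem expInner_add {d : ℕ} (ξ x y : E d) :
    expInner ξ (x + y) = expInner ξ x * expInner ξ y := by
  simp only [expInner, inner_add_right, ← Complex.exp_add]
  push_cast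
  ring_nf

theorem expInner_smul_comm {d : ℕ} (a : ℝ) (ξ x : E d) :
    expInner (a • ξ) x = expInner ξ (a • x) := by
  simp only [expInner, real_inner_smul_left, real_inner_smul_right]

theorem charFun_eq_integral_expInner {d : ℕ} (μ : Measure (E d)) (ξ : E d) :
    charFun μ ξ = ∫ x, expInner ξ x ∂μ := by
  rw [charFun_apply]
  simp_rw [expInner, real_inner_comm, mul_comm]

theorem hasDerivAt_expInner {d : ℕ} (ξ x v : E d) (t : ℝ) :
    HasDerivAt (fun t : ℝ => expInner ξ (x + t • v))
      (Complex.I * ((inner ℝ ξ v : ℝ) : ℂ) * expInner ξ (x + t • v)) t := by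
  have h1 : HasDerivAt (fun t : ℝ => inner ℝ ξ (x + t • v)) (inner ℝ ξ v) t := by
    simp_rw [inner_add_right, real_inner_smul_right]
    simpa using ((hasDerivAt_id t).mul_const (inner ℝ ξ v)).const_add (inner ℝ ξ x)
  have h2 := (h1.ofReal_comp.const_mul Complex.I).cexp
  rw [mul_comm] at h2
  exact h2

/-- The weights of a Schwartz function by polynomials of degree two are integrable. -/
theorem integrable_one_add_sq_mul_norm {d : ℕ} (F : 𝓢(E d, ℂ)) :
    Integrable fun ξ => (1 + ‖ξ‖ ^ 2) * ‖F ξ‖ := by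
  have h := F.integrable.norm.add (F.integrable_pow_mul volume 2)
  refine h.congr (Eventually.of_forall fun ξ => ?_)
  simp only [Pi.add_apply]
  ring

theorem integrable_mul_schwartz {d : ℕ} (F : 𝓢(E d, ℂ)) {g : E d → ℂ}
    (hg : AEStronglyMeasurable g) {C : ℝ} (hC : ∀ ξ, ‖g ξ‖ ≤ C * (1 + ‖ξ‖ ^ 2)) :
    Integrable fun ξ => g ξ * F ξ := by
  refine ((integrable_one_add_sq_mul_norm F).const_mul C).mono'
    (hg.mul F.continuous.aestronglyMeasurable) (Eventually.of_forall fun ξ => ?_)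
  rw [norm_mul, ← mul_assoc]
  gcongr
  exact hC ξ

theorem norm_le_one_add_sq {d : ℕ} (ξ : E d) : ‖ξ‖ ≤ 1 + ‖ξ‖ ^ 2 := by
  nlinarith [sq_nonneg (‖ξ‖ - 1)]

/-- The superposition `x ↦ ∫ e^{ic⟨ξ,x⟩} F(ξ) dξ`. -/
noncomputable def synth {d : ℕ} (c : ℝ) (F : E d → ℂ) (x : E d) : ℂ :=
  ∫ ξ, expInner (c • ξ) x * F ξ

theorem integrable_expInner_mul {d : ℕ} {g : E d → ℂ} (hg : Integrable g) (c : ℝ) (x : E d) :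
    Integrable fun ξ => expInner (c • ξ) x * g ξ :=
  hg.norm.mono' ((by fun_prop : Continuous fun ξ : E d => expInner (c • ξ) x).aestronglyMeasurable.mul
    hg.aestronglyMeasurable) (Eventually.of_forall fun ξ => by simp)

theorem integrable_inner_mul_schwartz {d : ℕ} (F : 𝓢(E d, ℂ)) (c : ℝ) (v : E d) :
    Integrable fun ξ => Complex.I * ((inner ℝ (c • ξ) v : ℝ) : ℂ) * F ξ := by
  refine integrable_mul_schwartz F
    (by fun_prop : Continuous fun ξ : E d => Complex.I * ((inner ℝ (c • ξ) v : ℝ) : ℂ)).aestronglyMeasurable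
    (C := |c| * ‖v‖) fun ξ => ?_
  rw [norm_mul, Complex.norm_I, one_mul, Complex.norm_real]
  refine (norm_inner_le_norm _ _).trans ?_
  rw [norm_smul, Real.norm_eq_abs, mul_right_comm]
  gcongr
  exact norm_le_one_add_sq ξ

theorem fderiv_of_eq_synth {d : ℕ} (F : 𝓢(E d, ℂ)) {c : ℝ} {f : E d → ℂ}
    (hd : Differentiable ℝ f) (hf : ∀ x, f x = synth c F x) (x v : E d) :
    fderiv ℝ f x v
      = ∫ ξ, expInner (c • ξ) x * (Complex.I * ((inner ℝ (c • ξ) v : ℝ) : ℂ) * F ξ) := by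
  have h1 : HasDerivAt (fun t : ℝ => f (x + t • v)) (fderiv ℝ f x v) 0 := by
    have hl : HasDerivAt (fun t : ℝ => x + t • v) v 0 := by
      simpa using ((hasDerivAt_id (0 : ℝ)).smul_const v).const_add x
    have := (hd (x + (0 : ℝ) • v)).hasFDerivAt.comp_hasDerivAt (0 : ℝ) hl
    rw [zero_smul, add_zero] at this
    exact this
  have h2 := (hasDerivAt_integral_of_dominated_loc_of_deriv_le
    (F := fun (t : ℝ) ξ => expInner (c • ξ) (x + t • v) * F ξ)
    (F' := fun (t : ℝ) ξ =>
      expInner (c • ξ) (x + t • v) * (Complex.I * ((inner ℝ (c • ξ) v : ℝ) : ℂ) * F ξ))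
    (bound := fun ξ => ‖Complex.I * ((inner ℝ (c • ξ) v : ℝ) : ℂ) * F ξ‖)
    (μ := (volume : Measure (E d))) (x₀ := 0) (s := univ) univ_mem
    (Eventually.of_forall fun t =>
      (integrable_expInner_mul F.integrable c _).aestronglyMeasurable)
    (integrable_expInner_mul F.integrable c _)
    (integrable_expInner_mul (integrable_inner_mul_schwartz F c v) c _).aestronglyMeasurable
    (Eventually.of_forall fun ξ t _ => by rw [norm_mul, norm_expInner, one_mul])
    (integrable_inner_mul_schwartz F c v).norm
    (Eventually.of_forall fun ξ t _ => by
      have h := (hasDerivAt_expInner (c • ξ) x v t).mul_const (F ξ)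
      have e : Complex.I * ((inner ℝ (c • ξ) v : ℝ) : ℂ) * expInner (c • ξ) (x + t • v) * F ξ
          = expInner (c • ξ) (x + t • v) * (Complex.I * ((inner ℝ (c • ξ) v : ℝ) : ℂ) * F ξ) := by
        ring
      rw [e] at h
      exact h)).2
  simp only [zero_smul, add_zero] at h2
  refine h1.unique ?_
  simpa only [hf, synth] using h2

/-- The integro-differential operator `⟨b,∇f⟩ + ∫ (f(x+u) - f(x) - ⟨∇f(x),u⟩ 1_{‖u‖≤1}) ν(du)`. -/
noncomputable def levyGenerator {d : ℕ} {G : Type*} [NormedAddCommGroup G] [NormedSpace ℝ G]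
    (b : E d) (ν : Measure (E d)) (f : E d → G) (x : E d) : G :=
  fderiv ℝ f x b + ∫ u, (f (x + u) - f x - if ‖u‖ ≤ 1 then fderiv ℝ f x u else 0) ∂ν

/-- The compensated increment sends the character of frequency ξ to itself times the Lévy integrand,
and is linear under the superposition. -/
theorem increment_of_eq_synth {d : ℕ} (F : 𝓢(E d, ℂ)) {c : ℝ} {f : E d → ℂ}
    (hd : Differentiable ℝ f) (hf : ∀ x, f x = synth c F x) (x u : E d) :
    (f (x + u) - f x - if ‖u‖ ≤ 1 then fderiv ℝ f x u else 0)
      = ∫ ξ, expInner (c • ξ) x * (levyIntegrand (c • ξ) u * F ξ) := by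
  have i1 := integrable_expInner_mul F.integrable c (x + u)
  have i2 := integrable_expInner_mul F.integrable c x
  have i3 := integrable_expInner_mul (integrable_inner_mul_schwartz F c u) c x
  by_cases hu : ‖u‖ ≤ 1
  · rw [if_pos hu, fderiv_of_eq_synth F hd hf, hf, hf, synth, synth, ← integral_sub i1 i2,
      ← integral_sub (f := fun ξ => expInner (c • ξ) (x + u) * F ξ - expInner (c • ξ) x * F ξ)
        (i1.sub i2) i3]
    refine integral_congr_ae (Eventually.of_forall fun ξ => ?_)
    simp only [levyIntegrand, if_pos hu, expInner_add]
    rw [← expInner]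
    ring
  · rw [if_neg hu, sub_zero, hf, hf, synth, synth, ← integral_sub i1 i2]
    refine integral_congr_ae (Eventually.of_forall fun ξ => ?_)
    simp only [levyIntegrand, if_neg hu, expInner_add]
    rw [← expInner]
    ring

theorem integrable_prod_levyIntegrand {d : ℕ} {ν : Measure (E d)} [SFinite ν]
    (hν : ∫⁻ u, ENNReal.ofReal (min 1 (‖u‖ ^ 2)) ∂ν < ∞) (F : 𝓢(E d, ℂ)) (c : ℝ) (x : E d) :
    Integrable (fun p : E d × E d =>
      expInner (c • p.2) x * (levyIntegrand (c • p.2) p.1 * F p.2)) (ν.prod volume) := by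
  have hF : Integrable fun ξ => 2 * (1 + c ^ 2) * ((1 + ‖ξ‖ ^ 2) * ‖F ξ‖) :=
    (integrable_one_add_sq_mul_norm F).const_mul _
  refine ((integrable_min_one_sq hν).mul_prod hF).mono' ?_ (Eventually.of_forall fun p => ?_)
  · refine Measurable.aestronglyMeasurable ?_
    have h0 : Measurable fun p : E d × E d => c • p.2 :=
      (by fun_prop : Continuous fun p : E d × E d => c • p.2).measurable
    have h1 : Measurable fun p : E d × E d => levyIntegrand (c • p.2) p.1 :=
      measurable_levyIntegrand_comp h0 measurable_fst
    have h2 : Measurable fun p : E d × E d => expInner (c • p.2) x :=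
      (by fun_prop : Continuous fun p : E d × E d => expInner (c • p.2) x).measurable
    have h3 : Measurable fun p : E d × E d => F p.2 := F.continuous.measurable.comp measurable_snd
    exact h2.mul (h1.mul h3)
  · rw [norm_mul, norm_expInner, one_mul, norm_mul]
    have h := norm_levyIntegrand_le (c • p.2) p.1
    rw [norm_smul, mul_pow, Real.norm_eq_abs, sq_abs] at h
    have h' : 1 + c ^ 2 * ‖p.2‖ ^ 2 ≤ (1 + c ^ 2) * (1 + ‖p.2‖ ^ 2) := by
      nlinarith [sq_nonneg c, sq_nonneg ‖p.2‖]
    calc ‖levyIntegrand (c • p.2) p.1‖ * ‖F p.2‖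
        ≤ 2 * (1 + c ^ 2 * ‖p.2‖ ^ 2) * min 1 (‖p.1‖ ^ 2) * ‖F p.2‖ := by gcongr
      _ ≤ 2 * ((1 + c ^ 2) * (1 + ‖p.2‖ ^ 2)) * min 1 (‖p.1‖ ^ 2) * ‖F p.2‖ := by gcongr
      _ = _ := by ring

theorem integrable_increment_of_eq_synth {d : ℕ} {ν : Measure (E d)} [SFinite ν]
    (hν : ∫⁻ u, ENNReal.ofReal (min 1 (‖u‖ ^ 2)) ∂ν < ∞) (F : 𝓢(E d, ℂ)) {c : ℝ} {f : E d → ℂ}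
    (hd : Differentiable ℝ f) (hf : ∀ x, f x = synth c F x) (x : E d) :
    Integrable (fun u => f (x + u) - f x - if ‖u‖ ≤ 1 then fderiv ℝ f x u else 0) ν := by
  simp_rw [increment_of_eq_synth F hd hf]
  exact (integrable_prod_levyIntegrand hν F c x).integral_prod_left

/-- The generator acts on `∫ e^{ic⟨ξ,x⟩} F(ξ) dξ` by multiplication by the exponent. -/
theorem levyGenerator_of_eq_synth {d : ℕ} {ν : Measure (E d)} [SFinite ν]
    (hν : ∫⁻ u, ENNReal.ofReal (min 1 (‖u‖ ^ 2)) ∂ν < ∞) (b : E d) (F : 𝓢(E d, ℂ)) {c : ℝ}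
    {f : E d → ℂ} (hd : Differentiable ℝ f) (hf : ∀ x, f x = synth c F x) (x : E d) :
    levyGenerator b ν f x = synth c (fun ξ => levyExponent b 0 ν (c • ξ) * F ξ) x := by
  have hI := integrable_prod_levyIntegrand hν F c x
  rw [levyGenerator, fderiv_of_eq_synth F hd hf]
  simp_rw [increment_of_eq_synth F hd hf]
  rw [← integral_prod _ hI, integral_prod_symm _ hI,
    ← integral_add (integrable_expInner_mul (integrable_inner_mul_schwartz F c b) c x)
      hI.integral_prod_right, synth]
  refine integral_congr_ae (Eventually.of_forall fun ξ => ?_)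
  simp only [levyExponent_zero_eq]
  rw [integral_const_mul, integral_mul_const, real_inner_comm]
  ring

theorem integrable_levyExponent_mul {d : ℕ} {ν : Measure (E d)}
    (hν : ∫⁻ u, ENNReal.ofReal (min 1 (‖u‖ ^ 2)) ∂ν < ∞) (b : E d) (F : 𝓢(E d, ℂ)) (c : ℝ) :
    Integrable fun ξ => levyExponent b 0 ν (c • ξ) * F ξ := by
  obtain ⟨C, hC0, hC⟩ := exists_norm_levyExponent_le hν b
  refine integrable_mul_schwartz F ((continuous_levyExponent hν b).comp
    (continuous_const_smul c)).aestronglyMeasurable (C := C * (1 + c ^ 2)) fun ξ => ?_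
  refine (hC _).trans ?_
  rw [mul_assoc]
  gcongr
  rw [norm_smul, mul_pow, Real.norm_eq_abs, sq_abs]
  nlinarith [sq_nonneg c, sq_nonneg ‖ξ‖]

theorem integrable_prod_expInner_mul {d : ℕ} (μ : Measure (E d)) [IsFiniteMeasure μ] {g : E d → ℂ}
    (hg : Integrable g) (c : ℝ) :
    Integrable (fun p : E d × E d => expInner (c • p.2) p.1 * g p.2) (μ.prod volume) := by
  have h1 : Integrable (fun p : E d × E d => (1 : ℂ) * g p.2) (μ.prod volume) :=
    (integrable_const (1 : ℂ)).mul_prod hg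
  refine h1.norm.mono' ?_ (Eventually.of_forall fun p => by simp)
  have h2 : Continuous fun p : E d × E d => expInner (c • p.2) p.1 := by fun_prop
  exact h2.aestronglyMeasurable.mul (by simpa using h1.aestronglyMeasurable)

theorem integrable_synth {d : ℕ} (μ : Measure (E d)) [IsFiniteMeasure μ] {g : E d → ℂ}
    (hg : Integrable g) (c : ℝ) : Integrable (synth c g) μ :=
  (integrable_prod_expInner_mul μ hg c).integral_prod_left

theorem integral_synth {d : ℕ} (μ : Measure (E d)) [IsFiniteMeasure μ] {g : E d → ℂ}
    (hg : Integrable g) (c : ℝ) : ∫ x, synth c g x ∂μ = ∫ ξ, charFun μ (c • ξ) * g ξ := by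
  have hI := integrable_prod_expInner_mul μ hg c
  simp_rw [synth]
  rw [← integral_prod _ hI, integral_prod_symm _ hI]
  refine integral_congr_ae (Eventually.of_forall fun ξ => ?_)
  simp only
  rw [integral_mul_const, ← charFun_eq_integral_expInner]

theorem fourierInv_eq_synth {d : ℕ} (F : 𝓢(E d, ℂ)) (x : E d) :
    (FourierTransformInv.fourierInv F : 𝓢(E d, ℂ)) x = synth (2 * Real.pi) F x := by
  rw [SchwartzMap.fourierInv_coe, Real.fourierInv_eq', synth]
  refine integral_congr_ae (Eventually.of_forall fun ξ => ?_)
  simp only [expInner, real_inner_smul_left, smul_eq_mul, mul_comm]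

theorem eq_synth_fourier {d : ℕ} (f : 𝓢(E d, ℂ)) (x : E d) :
    f x = synth (2 * Real.pi) (FourierTransform.fourier f : 𝓢(E d, ℂ)) x := by
  rw [← fourierInv_eq_synth, FourierTransform.fourierInv_fourier_eq]

theorem continuous_charFun_E {d : ℕ} (μ : Measure (E d)) [IsFiniteMeasure μ] :
    Continuous (charFun μ) := by
  simp_rw [funext (charFun_eq_integral_expInner μ)]
  refine continuous_of_dominated (bound := fun _ => 1) ?_ ?_ (integrable_const _) ?_
  · exact fun ξ => (by fun_prop : Continuous fun x => expInner ξ x).aestronglyMeasurable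
  · exact fun ξ => Eventually.of_forall fun x => by simp
  · exact Eventually.of_forall fun x => by fun_prop

/-! ### Dilations of Schwartz functions. -/

theorem exists_norm_fderiv_self_le {d : ℕ} {G : Type*} [NormedAddCommGroup G] [NormedSpace ℝ G]
    (f : 𝓢(E d, G)) : ∃ C, ∀ x, ‖fderiv ℝ f x x‖ ≤ C := by
  obtain ⟨C, hC⟩ := f.decay 1 1
  refine ⟨C, fun x => ((fderiv ℝ f x).le_opNorm x).trans ?_⟩
  simpa [norm_iteratedFDeriv_one, mul_comm] using hC.2 x

theorem continuous_fderiv_schwartz {d : ℕ} {G : Type*} [NormedAddCommGroup G] [NormedSpace ℝ G]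
    (f : 𝓢(E d, G)) : Continuous (fderiv ℝ f) :=
  (f.smooth 1).continuous_fderiv one_ne_zero

/-- Decay of ∇f compensates the factor x, so no moment of μ is needed. -/
theorem integrable_fderiv_self {d : ℕ} {G : Type*} [NormedAddCommGroup G] [NormedSpace ℝ G]
    (μ : Measure (E d)) [IsFiniteMeasure μ] (f : 𝓢(E d, G)) :
    Integrable (fun x => fderiv ℝ f x x) μ := by
  obtain ⟨C, hC⟩ := exists_norm_fderiv_self_le f
  exact (integrable_const C).mono'
    ((continuous_fderiv_schwartz f).clm_apply continuous_id).aestronglyMeasurable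
    (Eventually.of_forall hC)

/-- `∂_τ ∫ f(e^{-τ} x) μ(dx) = -∫ ⟨∇f(y), y⟩ μ(dx)` with `y = e^{-τ} x`. -/
theorem hasDerivAt_integral_dilation {d : ℕ} (μ : Measure (E d)) [IsFiniteMeasure μ]
    (f : 𝓢(E d, ℂ)) (τ : ℝ) :
    HasDerivAt (fun τ => ∫ x, f (Real.exp (-τ) • x) ∂μ)
      (-∫ x, fderiv ℝ f (Real.exp (-τ) • x) (Real.exp (-τ) • x) ∂μ) τ := by
  obtain ⟨C, hC⟩ := exists_norm_fderiv_self_le f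
  have hc : ∀ τ : ℝ, Continuous fun x : E d => Real.exp (-τ) • x := fun τ => by fun_prop
  have hfint : Integrable (fun x => f (Real.exp (-τ) • x)) μ := by
    obtain ⟨C', hC'⟩ := f.decay 0 0
    refine (integrable_const C').mono' (f.continuous.comp (hc τ)).aestronglyMeasurable
      (Eventually.of_forall fun x => by simpa using hC'.2 (Real.exp (-τ) • x))
  have hcont : Continuous fun x => fderiv ℝ f (Real.exp (-τ) • x) (Real.exp (-τ) • x) :=
    ((continuous_fderiv_schwartz f).comp (hc τ)).clm_apply (hc τ)
  have h := (hasDerivAt_integral_of_dominated_loc_of_deriv_le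
    (F := fun (τ : ℝ) x => f (Real.exp (-τ) • x))
    (F' := fun (τ : ℝ) x => -fderiv ℝ f (Real.exp (-τ) • x) (Real.exp (-τ) • x))
    (bound := fun _ => C) (μ := μ) (x₀ := τ) (s := univ) univ_mem
    (Eventually.of_forall fun τ => (f.continuous.comp (hc τ)).aestronglyMeasurable)
    hfint hcont.neg.aestronglyMeasurable
    (Eventually.of_forall fun x τ _ => by rw [norm_neg]; exact hC _)
    (integrable_const C)
    (Eventually.of_forall fun x τ _ => by
      have h1 : HasDerivAt (fun τ : ℝ => Real.exp (-τ) • x) (-(Real.exp (-τ) • x)) τ := by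
        have := ((hasDerivAt_id τ).neg.exp).smul_const x
        simpa using this
      have h2 := f.differentiableAt.hasFDerivAt.comp_hasDerivAt τ h1
      rw [map_neg] at h2
      exact h2)).2
  rwa [integral_neg] at h

/-- The Schwartz function `x ↦ f(a x)`. -/
noncomputable def dilate {d : ℕ} {a : ℝ} (ha : a ≠ 0) (f : 𝓢(E d, ℂ)) : 𝓢(E d, ℂ) :=
  SchwartzMap.compCLMOfContinuousLinearEquiv ℂ
    (ContinuousLinearEquiv.smulLeft (Units.mk0 a ha) : E d ≃L[ℝ] E d) f

theorem dilate_apply {d : ℕ} {a : ℝ} (ha : a ≠ 0) (f : 𝓢(E d, ℂ)) (x : E d) :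
    dilate ha f x = f (a • x) := rfl

theorem fderiv_dilate_apply {d : ℕ} {a : ℝ} (ha : a ≠ 0) (f : 𝓢(E d, ℂ)) (x v : E d) :
    fderiv ℝ (dilate ha f) x v = fderiv ℝ f (a • x) (a • v) := by
  have h1 : HasFDerivAt (fun x : E d => a • x) (a • ContinuousLinearMap.id ℝ (E d)) x :=
    (hasFDerivAt_id x).const_smul a
  have h2 := (f.differentiableAt (x := a • x)).hasFDerivAt.comp x h1
  have h3 : HasFDerivAt (dilate ha f)
    ((fderiv ℝ f (a • x)).comp (a • ContinuousLinearMap.id ℝ (E d))) x := h2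
  rw [h3.fderiv]
  simp

theorem synth_smul {d : ℕ} (c a : ℝ) (F : E d → ℂ) (x : E d) :
    synth c F (a • x) = synth (a * c) F x := by
  simp_rw [synth, ← smul_smul, expInner_smul_comm a]

/-! ### Equivalence of the Stein identity and the flow equation. -/

/-- The Stein identity for complex-valued Schwartz functions. -/
def ComplexStein {d : ℕ} (μ : Measure (E d)) (b : E d) (ν : Measure (E d)) : Prop :=
  ∀ f : 𝓢(E d, ℂ), ∫ x, fderiv ℝ f x x ∂μ = ∫ x, levyGenerator b ν f x ∂μ

theorem integral_levyGenerator_of_eq_synth {d : ℕ} (μ : Measure (E d)) [IsFiniteMeasure μ]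
    {ν : Measure (E d)} [SFinite ν] (hν : ∫⁻ u, ENNReal.ofReal (min 1 (‖u‖ ^ 2)) ∂ν < ∞)
    (b : E d) (F : 𝓢(E d, ℂ)) {c : ℝ} {f : E d → ℂ} (hd : Differentiable ℝ f)
    (hf : ∀ x, f x = synth c F x) :
    ∫ x, levyGenerator b ν f x ∂μ
      = ∫ ξ, charFun μ (c • ξ) * (levyExponent b 0 ν (c • ξ) * F ξ) := by
  simp_rw [levyGenerator_of_eq_synth hν b F hd hf]
  exact integral_synth μ (integrable_levyExponent_mul hν b F c) c

/-- `∫ f(e^{-τ}x) μ(dx)` in Fourier variables. -/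
theorem integral_dilation_of_eq_synth {d : ℕ} (μ : Measure (E d)) [IsFiniteMeasure μ]
    (F : 𝓢(E d, ℂ)) {c : ℝ} {f : E d → ℂ} (hf : ∀ x, f x = synth c F x) (a : ℝ) :
    ∫ x, f (a • x) ∂μ = ∫ ξ, charFun μ ((a * c) • ξ) * F ξ := by
  simp_rw [hf, synth_smul]
  exact integral_synth μ F.integrable _

/-- If `charFun μ` solves the flow equation, then `μ` satisfies the Stein identity. -/
theorem complexStein_of_hasDerivAt {d : ℕ} (μ : Measure (E d)) [IsProbabilityMeasure μ]
    {ν : Measure (E d)} [SFinite ν] (hν : ∫⁻ u, ENNReal.ofReal (min 1 (‖u‖ ^ 2)) ∂ν < ∞) (b : E d)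
    (h : ∀ ξ τ, HasDerivAt (fun τ : ℝ => charFun μ (Real.exp (-τ) • ξ))
      (-(charFun μ (Real.exp (-τ) • ξ) * levyExponent b 0 ν (Real.exp (-τ) • ξ))) τ) :
    ComplexStein μ b ν := by
  intro f
  -- The factor 2π throughout comes from the normalization e^{2πi⟨ξ,x⟩} of the Fourier transform.
  set F : 𝓢(E d, ℂ) := FourierTransform.fourier f
  have hf : ∀ x, f x = synth (2 * Real.pi) F x := eq_synth_fourier f
  have h1 := hasDerivAt_integral_dilation μ f 0
  obtain ⟨C, hC0, hC⟩ := exists_norm_levyExponent_le hν b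
  have hΦ := continuous_levyExponent hν b
  have hφ := continuous_charFun_E μ
  have h2 := (hasDerivAt_integral_of_dominated_loc_of_deriv_le
    (F := fun (τ : ℝ) ξ => charFun μ (Real.exp (-τ) • (2 * Real.pi) • ξ) * F ξ)
    (F' := fun (τ : ℝ) ξ => -(charFun μ (Real.exp (-τ) • (2 * Real.pi) • ξ)
      * levyExponent b 0 ν (Real.exp (-τ) • (2 * Real.pi) • ξ)) * F ξ)
    (bound := fun ξ => C * (1 + (Real.exp 1 * (2 * Real.pi)) ^ 2) * ((1 + ‖ξ‖ ^ 2) * ‖F ξ‖))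
    (μ := (volume : Measure (E d))) (x₀ := 0) (s := Metric.ball 0 1)
    (Metric.ball_mem_nhds _ one_pos)
    (Eventually.of_forall fun τ => Continuous.aestronglyMeasurable (by fun_prop))
    ?_ (Continuous.aestronglyMeasurable (by fun_prop)) (Eventually.of_forall fun ξ τ hτ => ?_)
    ((integrable_one_add_sq_mul_norm F).const_mul _)
    (Eventually.of_forall fun ξ τ _ => (h _ τ).mul_const (F ξ))).2
  -- The same function of τ has been differentiated at 0 in space (`h1`) and in frequency (`h2`);
  -- uniqueness of the derivative is the Stein identity.
  · have e : ∀ τ : ℝ, ∫ x, f (Real.exp (-τ) • x) ∂μ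
        = ∫ ξ, charFun μ (Real.exp (-τ) • (2 * Real.pi) • ξ) * F ξ := fun τ => by
      simp_rw [integral_dilation_of_eq_synth μ F hf, smul_smul]
    simp_rw [e] at h1
    have h3 := h1.unique h2
    simp only [neg_zero, Real.exp_zero, one_smul, neg_mul, integral_neg, neg_inj] at h3
    rw [h3, integral_levyGenerator_of_eq_synth μ hν b F f.differentiable hf]
    simp_rw [mul_assoc]
  · refine F.integrable.norm.mono' (Continuous.aestronglyMeasurable (by fun_prop))
      (Eventually.of_forall fun ξ => ?_)
    rw [norm_mul]
    exact mul_le_of_le_one_left (norm_nonneg _) (norm_charFun_le_one _)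
  · have hτ1 : Real.exp (-τ) ≤ Real.exp 1 := by
      rw [Metric.mem_ball, dist_zero_right, Real.norm_eq_abs] at hτ
      exact Real.exp_le_exp.mpr (by linarith [(abs_lt.mp hτ).1])
    have hn : ‖Real.exp (-τ) • (2 * Real.pi) • ξ‖ ≤ Real.exp 1 * (2 * Real.pi) * ‖ξ‖ := by
      rw [smul_smul, norm_smul, Real.norm_of_nonneg (by positivity)]
      gcongr
    rw [norm_mul, norm_neg, norm_mul, ← mul_assoc]
    refine mul_le_mul_of_nonneg_right ?_ (norm_nonneg _)
    refine (mul_le_of_le_one_left (norm_nonneg _) (norm_charFun_le_one _)).trans ((hC _).trans ?_)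
    rw [mul_assoc]
    refine mul_le_mul_of_nonneg_left ?_ hC0
    have := pow_le_pow_left₀ (norm_nonneg _) hn 2
    rw [mul_pow] at this
    nlinarith [sq_nonneg (Real.exp 1 * (2 * Real.pi)), sq_nonneg ‖ξ‖]

/-- A continuous function whose integrals against all Schwartz functions vanish is zero. -/
theorem eq_zero_of_integral_mul_schwartz {d : ℕ} {B : E d → ℂ} (hB : Continuous B)
    (h : ∀ F : 𝓢(E d, ℂ), ∫ ξ, B ξ * F ξ = 0) (ξ : E d) : B ξ = 0 := by
  have hae : ∀ᵐ ξ ∂(volume : Measure (E d)), B ξ = 0 := by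
    refine ae_eq_zero_of_integral_contDiff_smul_eq_zero hB.locallyIntegrable fun g hg hgs => ?_
    have hs : HasCompactSupport fun x => (g x : ℂ) :=
      hgs.comp_left (g := ((↑) : ℝ → ℂ)) Complex.ofReal_zero
    have := h (hs.toSchwartzMap (Complex.ofRealCLM.contDiff.comp hg))
    rw [← this]
    refine integral_congr_ae (Eventually.of_forall fun ξ => ?_)
    exact (Complex.real_smul).trans (mul_comm _ _)
  exact congrFun ((hB.ae_eq_iff_eq (μ := volume) continuous_const).mp hae) ξ

/-- The right-hand side of the flow equation at time `s`. -/
noncomputable def flowField {d : ℕ} (μ : Measure (E d)) (b : E d) (ν : Measure (E d)) (s : ℝ)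
    (ξ : E d) : ℂ :=
  charFun μ (Real.exp (-s) • ξ) * levyExponent b 0 ν (Real.exp (-s) • ξ)

theorem continuous_flowField {d : ℕ} (μ : Measure (E d)) [IsFiniteMeasure μ] {ν : Measure (E d)}
    (hν : ∫⁻ u, ENNReal.ofReal (min 1 (‖u‖ ^ 2)) ∂ν < ∞) (b : E d)
    {α : Type*} [TopologicalSpace α] {s : α → ℝ} {ξ : α → E d} (hs : Continuous s)
    (hξ : Continuous ξ) : Continuous fun a => flowField μ b ν (s a) (ξ a) := by
  have hΦ := continuous_levyExponent hν b
  have hφ := continuous_charFun_E μ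
  unfold flowField
  fun_prop

theorem exists_norm_flowField_le {d : ℕ} (μ : Measure (E d)) [IsProbabilityMeasure μ]
    {ν : Measure (E d)} (hν : ∫⁻ u, ENNReal.ofReal (min 1 (‖u‖ ^ 2)) ∂ν < ∞) (b : E d) (T c : ℝ) :
    ∃ C, ∀ s, -s ≤ T → ∀ ξ, ‖flowField μ b ν s (c • ξ)‖ ≤ C * (1 + ‖ξ‖ ^ 2) := by
  obtain ⟨C, hC0, hC⟩ := exists_norm_levyExponent_le hν b
  refine ⟨C * (1 + (Real.exp T * |c|) ^ 2), fun s hs ξ => ?_⟩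
  have hn : ‖Real.exp (-s) • c • ξ‖ ≤ Real.exp T * |c| * ‖ξ‖ := by
    rw [smul_smul, norm_smul, norm_mul, Real.norm_of_nonneg (Real.exp_pos _).le, Real.norm_eq_abs]
    gcongr
  rw [flowField, norm_mul]
  refine (mul_le_of_le_one_left (norm_nonneg _) (norm_charFun_le_one _)).trans ((hC _).trans ?_)
  rw [mul_assoc]
  refine mul_le_mul_of_nonneg_left ?_ hC0
  have := pow_le_pow_left₀ (norm_nonneg _) hn 2
  rw [mul_pow] at this
  nlinarith [sq_nonneg (Real.exp T * |c|), sq_nonneg ‖ξ‖]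

theorem integrable_prod_flowField {d : ℕ} (μ : Measure (E d)) [IsProbabilityMeasure μ]
    {ν : Measure (E d)} (hν : ∫⁻ u, ENNReal.ofReal (min 1 (‖u‖ ^ 2)) ∂ν < ∞) (b : E d)
    (F : 𝓢(E d, ℂ)) (c τ : ℝ) :
    Integrable (Function.uncurry fun s ξ => flowField μ b ν s (c • ξ) * F ξ)
      ((volume.restrict (uIoc 0 τ)).prod volume) := by
  obtain ⟨C, hC⟩ := exists_norm_flowField_le μ hν b |τ| c
  have : IsFiniteMeasure (volume.restrict (uIoc 0 τ)) := by unfold uIoc; infer_instance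
  have hbd : Integrable (fun p : ℝ × E d => (1 : ℝ) * (C * ((1 + ‖p.2‖ ^ 2) * ‖F p.2‖)))
      ((volume.restrict (uIoc 0 τ)).prod volume) :=
    (integrable_const (1 : ℝ)).mul_prod ((integrable_one_add_sq_mul_norm F).const_mul _)
  have hcont : Continuous (Function.uncurry fun s ξ => flowField μ b ν s (c • ξ) * F ξ) :=
    (continuous_flowField μ hν b continuous_fst (continuous_snd.const_smul c)).mul
      (F.continuous.comp continuous_snd)
  refine hbd.mono' hcont.aestronglyMeasurable ?_
  have hmem : ∀ᵐ p ∂((volume.restrict (uIoc 0 τ)).prod (volume : Measure (E d))),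
      p.1 ∈ uIoc 0 τ :=
    Measure.quasiMeasurePreserving_fst.ae (ae_restrict_mem measurableSet_uIoc)
  filter_upwards [hmem] with p hp
  have hτ : -p.1 ≤ |τ| := by
    rcases mem_uIoc.mp hp with hp | hp
    · exact (neg_nonpos.mpr hp.1.le).trans (abs_nonneg τ)
    · exact (neg_le_neg hp.1.le).trans (neg_le_abs τ)
  rw [Function.uncurry, norm_mul, one_mul, ← mul_assoc]
  exact mul_le_mul_of_nonneg_right (hC _ hτ _) (norm_nonneg _)

/-- The Stein identity is applied to x ↦ f(e^{-s}x), again a Schwartz function, which turns an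
identity at time 0 into a derivative at every time s. -/
theorem hasDerivAt_integral_charFun_mul_of_complexStein {d : ℕ} (μ : Measure (E d))
    [IsProbabilityMeasure μ] {ν : Measure (E d)} [SFinite ν]
    (hν : ∫⁻ u, ENNReal.ofReal (min 1 (‖u‖ ^ 2)) ∂ν < ∞) (b : E d)
    (h : ComplexStein μ b ν) (F : 𝓢(E d, ℂ)) (s : ℝ) :
    HasDerivAt (fun τ : ℝ => ∫ ξ, charFun μ (Real.exp (-τ) • (2 * Real.pi) • ξ) * F ξ)
      (-∫ ξ, flowField μ b ν s ((2 * Real.pi) • ξ) * F ξ) s := by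
  set f : 𝓢(E d, ℂ) := FourierTransformInv.fourierInv F
  have hf : ∀ x, f x = synth (2 * Real.pi) F x := fourierInv_eq_synth F
  have hne := (Real.exp_pos (-s)).ne'
  have h1 := hasDerivAt_integral_dilation μ f s
  have h2 := h (dilate hne f)
  simp_rw [fderiv_dilate_apply] at h2
  rw [integral_levyGenerator_of_eq_synth μ hν b F (c := Real.exp (-s) * (2 * Real.pi))
    (dilate hne f).differentiable (fun x => by rw [dilate_apply, hf, synth_smul])] at h2
  rw [h2] at h1
  simp_rw [integral_dilation_of_eq_synth μ F hf] at h1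
  simpa only [flowField, smul_smul, mul_assoc] using h1

/-- The Stein identity in integrated form along the flow `ξ ↦ e^{-τ}ξ`, tested against a
Schwartz function. -/
theorem integral_mul_schwartz_eq_zero_of_complexStein {d : ℕ} (μ : Measure (E d))
    [IsProbabilityMeasure μ] {ν : Measure (E d)} [SFinite ν]
    (hν : ∫⁻ u, ENNReal.ofReal (min 1 (‖u‖ ^ 2)) ∂ν < ∞) (b : E d)
    (h : ComplexStein μ b ν) (τ : ℝ) (F : 𝓢(E d, ℂ)) :
    ∫ ξ, (charFun μ (Real.exp (-τ) • (2 * Real.pi) • ξ) - charFun μ ((2 * Real.pi) • ξ)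
      + ∫ s in (0 : ℝ)..τ, flowField μ b ν s ((2 * Real.pi) • ξ)) * F ξ = 0 := by
  have hφ := continuous_charFun_E μ
  have hint := integrable_prod_flowField μ hν b F (2 * Real.pi) τ
  have hswap : ∫ s in (0 : ℝ)..τ, (∫ ξ, flowField μ b ν s ((2 * Real.pi) • ξ) * F ξ)
      = ∫ ξ, (∫ s in (0 : ℝ)..τ, flowField μ b ν s ((2 * Real.pi) • ξ)) * F ξ := by
    rw [intervalIntegral_integral_swap hint]
    simp_rw [intervalIntegral.integral_mul_const]
  have hii : IntervalIntegrable
      (fun s => ∫ ξ, flowField μ b ν s ((2 * Real.pi) • ξ) * F ξ) volume 0 τ := by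
    rw [intervalIntegrable_iff]
    exact hint.integral_prod_left
  -- After integration in time, every term tested against F is continuous in ξ, so the test function
  -- can later be removed without knowing that φ is differentiable.
  have hFTC := intervalIntegral.integral_eq_sub_of_hasDerivAt
    (fun s _ => hasDerivAt_integral_charFun_mul_of_complexStein μ hν b h F s) hii.neg
  rw [intervalIntegral.integral_neg, hswap] at hFTC
  simp only [neg_zero, Real.exp_zero, one_smul] at hFTC
  have hbdd : ∀ a : ℝ, Integrable fun ξ => charFun μ (a • (2 * Real.pi) • ξ) * F ξ := fun a =>
    F.integrable.norm.mono' (Continuous.aestronglyMeasurable (by fun_prop))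
      (Eventually.of_forall fun ξ => by
        rw [norm_mul]
        exact mul_le_of_le_one_left (norm_nonneg _) (norm_charFun_le_one _))
  have i1 := hbdd (Real.exp (-τ))
  have i2 := hbdd 1
  simp only [one_smul] at i2
  have i3 : Integrable fun ξ =>
      (∫ s in (0 : ℝ)..τ, flowField μ b ν s ((2 * Real.pi) • ξ)) * F ξ := by
    have := hint.integral_prod_right
    simp only [Function.uncurry, integral_mul_const] at this
    simp_rw [intervalIntegral.intervalIntegral_eq_integral_uIoc, smul_mul_assoc]
    exact this.smul _
  simp_rw [add_mul, sub_mul]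
  rw [integral_add (f := fun ξ => charFun μ (Real.exp (-τ) • (2 * Real.pi) • ξ) * F ξ
      - charFun μ ((2 * Real.pi) • ξ) * F ξ) (i1.sub i2) i3, integral_sub i1 i2, ← hFTC]
  ring

/-- The Stein identity in integrated form along the flow `ξ ↦ e^{-τ}ξ`. -/
theorem charFun_sub_eq_integral_of_complexStein {d : ℕ} (μ : Measure (E d))
    [IsProbabilityMeasure μ] {ν : Measure (E d)} [SFinite ν]
    (hν : ∫⁻ u, ENNReal.ofReal (min 1 (‖u‖ ^ 2)) ∂ν < ∞) (b : E d)
    (h : ComplexStein μ b ν) (τ : ℝ) (ξ : E d) :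
    charFun μ (Real.exp (-τ) • ξ)
      = charFun μ ξ - ∫ s in (0 : ℝ)..τ, flowField μ b ν s ξ := by
  have hφ := continuous_charFun_E μ
  have hJ : Continuous fun ξ => ∫ s in (0 : ℝ)..τ, flowField μ b ν s ξ :=
    intervalIntegral.continuous_parametric_intervalIntegral_of_continuous'
      (f := fun ξ s => flowField μ b ν s ξ)
      (continuous_flowField μ hν b continuous_snd continuous_fst) 0 τ
  have hJ' : Continuous fun ξ => ∫ s in (0 : ℝ)..τ, flowField μ b ν s ((2 * Real.pi) • ξ) :=
    hJ.comp (continuous_const_smul (2 * Real.pi))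
  have hB : Continuous fun ξ => charFun μ (Real.exp (-τ) • (2 * Real.pi) • ξ)
      - charFun μ ((2 * Real.pi) • ξ)
      + ∫ s in (0 : ℝ)..τ, flowField μ b ν s ((2 * Real.pi) • ξ) :=
    Continuous.add (by fun_prop) hJ'
  have hz := eq_zero_of_integral_mul_schwartz hB
    (integral_mul_schwartz_eq_zero_of_complexStein μ hν b h τ) ((2 * Real.pi)⁻¹ • ξ)
  rw [smul_inv_smul₀ Real.two_pi_pos.ne'] at hz
  linear_combination hz

/-- The Stein identity gives the flow equation of the characteristic function. -/
theorem hasDerivAt_charFun_of_complexStein {d : ℕ} (μ : Measure (E d))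
    [IsProbabilityMeasure μ] {ν : Measure (E d)} [SFinite ν]
    (hν : ∫⁻ u, ENNReal.ofReal (min 1 (‖u‖ ^ 2)) ∂ν < ∞) (b : E d)
    (h : ComplexStein μ b ν) (ξ : E d) (τ : ℝ) :
    HasDerivAt (fun τ : ℝ => charFun μ (Real.exp (-τ) • ξ))
      (-flowField μ b ν τ ξ) τ := by
  have hcont : Continuous fun s : ℝ => flowField μ b ν s ξ :=
    continuous_flowField μ hν b continuous_id continuous_const
  rw [funext fun τ => charFun_sub_eq_integral_of_complexStein μ hν b h τ ξ]
  have hd := intervalIntegral.integral_hasDerivAt_right (hcont.intervalIntegrable 0 τ)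
    (hcont.stronglyMeasurableAtFilter _ _) hcont.continuousAt
  exact hd.const_sub (charFun μ ξ)

/-- The Stein identity characterizes the law with exponent `ψ`, when `ψ` has derivative minus the
exponent of `ν` along the flow `ξ ↦ e^{-τ}ξ`. -/
theorem complexStein_iff_charFun_eq {d : ℕ} (μ : Measure (E d)) [IsProbabilityMeasure μ]
    {ν : Measure (E d)} [SFinite ν] (hν : ∫⁻ u, ENNReal.ofReal (min 1 (‖u‖ ^ 2)) ∂ν < ∞) (b : E d)
    {ψ : E d → ℂ} (hψ : Continuous ψ) (hψ0 : ψ 0 = 0)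
    (hflow : ∀ ξ τ, HasDerivAt (fun τ : ℝ => ψ (Real.exp (-τ) • ξ))
      (-levyExponent b 0 ν (Real.exp (-τ) • ξ)) τ) :
    ComplexStein μ b ν ↔ ∀ ξ, charFun μ ξ = Complex.exp (ψ ξ) := by
  constructor
  · intro h ξ
    -- Both factors have logarithmic derivative ∓ψ̃ along the flow, so the product is constant.
    -- Using e^{-ψ} avoids dividing by φ, which might vanish.
    have hd : ∀ τ, HasDerivAt (fun τ : ℝ => charFun μ (Real.exp (-τ) • ξ)
        * Complex.exp (-ψ (Real.exp (-τ) • ξ))) 0 τ := by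
      intro τ
      have h1 := hasDerivAt_charFun_of_complexStein μ hν b h ξ τ
      rw [flowField] at h1
      refine (h1.mul (hflow ξ τ).neg.cexp).congr_deriv ?_
      ring
    have hconst : ∀ τ : ℝ, charFun μ (Real.exp (-τ) • ξ) * Complex.exp (-ψ (Real.exp (-τ) • ξ))
        = charFun μ ξ * Complex.exp (-ψ ξ) := by
      intro τ
      have := is_const_of_deriv_eq_zero (fun τ => (hd τ).differentiableAt)
        (fun τ => (hd τ).deriv) τ 0
      simpa using this
    -- The flow contracts to 0, where φ e^{-ψ} = 1; this fixes the constant.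
    have hlim : Tendsto (fun τ : ℝ => Real.exp (-τ) • ξ) atTop (𝓝 0) := by
      simpa using (Real.tendsto_exp_neg_atTop_nhds_zero).smul_const ξ
    have hg : Continuous fun η => charFun μ η * Complex.exp (-ψ η) := by
      have hφ := continuous_charFun_E μ
      fun_prop
    have h1 := (hg.tendsto 0).comp hlim
    have h2 : Tendsto ((fun η => charFun μ η * Complex.exp (-ψ η)) ∘
        fun τ : ℝ => Real.exp (-τ) • ξ) atTop (𝓝 (charFun μ ξ * Complex.exp (-ψ ξ))) :=
      tendsto_const_nhds.congr fun τ => (hconst τ).symm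
    have h3 := tendsto_nhds_unique h2 h1
    simp only [charFun_zero, hψ0, neg_zero, Complex.exp_zero, probReal_univ, Complex.ofReal_one,
      mul_one] at h3
    rw [Complex.exp_neg, mul_inv_eq_one₀ (Complex.exp_ne_zero _)] at h3
    exact h3
  · intro h
    refine complexStein_of_hasDerivAt μ hν b fun ξ τ => ?_
    simp_rw [h]
    refine (hflow ξ τ).cexp.congr_deriv ?_
    ring

/-! ### Real test functions and the stated form of the identity. -/

theorem fderiv_clm_comp_apply {d : ℕ} (L : ℂ →L[ℝ] ℝ) (g : 𝓢(E d, ℂ)) (x v : E d) :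
    fderiv ℝ (fun x => L (g x)) x v = L (fderiv ℝ g x v) := by
  have h : HasFDerivAt (fun x => L (g x)) (L.comp (fderiv ℝ g x)) x :=
    L.hasFDerivAt.comp x g.differentiableAt.hasFDerivAt
  rw [h.fderiv]
  rfl

/-- Moving L through the integral over ν needs integrability of the increment, which the Fourier
representation of g supplies. -/
theorem levyGenerator_clm_comp {d : ℕ} {ν : Measure (E d)} [SFinite ν]
    (hν : ∫⁻ u, ENNReal.ofReal (min 1 (‖u‖ ^ 2)) ∂ν < ∞) (b : E d) (L : ℂ →L[ℝ] ℝ)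
    (g : 𝓢(E d, ℂ)) (x : E d) :
    levyGenerator b ν (fun x => L (g x)) x = L (levyGenerator b ν g x) := by
  have hI := integrable_increment_of_eq_synth hν _ g.differentiable (eq_synth_fourier g) x
  rw [levyGenerator, levyGenerator, map_add, ← L.integral_comp_comm hI, fderiv_clm_comp_apply]
  congr 1
  refine integral_congr_ae (Eventually.of_forall fun u => ?_)
  simp only [fderiv_clm_comp_apply]
  split_ifs <;> simp

theorem integrable_levyGenerator {d : ℕ} (μ : Measure (E d)) [IsFiniteMeasure μ]
    {ν : Measure (E d)} [SFinite ν] (hν : ∫⁻ u, ENNReal.ofReal (min 1 (‖u‖ ^ 2)) ∂ν < ∞)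
    (b : E d) (g : 𝓢(E d, ℂ)) : Integrable (levyGenerator b ν g) μ := by
  rw [funext (levyGenerator_of_eq_synth hν b _ g.differentiable (eq_synth_fourier g))]
  exact integrable_synth μ (integrable_levyExponent_mul hν b _ _) _

/-- The complexification of a real-valued Schwartz function. -/
noncomputable def complexify {d : ℕ} (f : 𝓢(E d, ℝ)) : 𝓢(E d, ℂ) :=
  f.postcompCLM (Complex.ofRealCLM : ℝ →L[ℝ] ℂ)

theorem reCLM_complexify {d : ℕ} (f : 𝓢(E d, ℝ)) :
    (fun x => Complex.reCLM (complexify f x)) = f := by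
  ext x; simp [complexify]

theorem integrable_levyGenerator_real {d : ℕ} (μ : Measure (E d)) [IsFiniteMeasure μ]
    {ν : Measure (E d)} [SFinite ν] (hν : ∫⁻ u, ENNReal.ofReal (min 1 (‖u‖ ^ 2)) ∂ν < ∞)
    (b : E d) (f : 𝓢(E d, ℝ)) : Integrable (levyGenerator b ν f) μ := by
  rw [← reCLM_complexify f, funext (levyGenerator_clm_comp hν b Complex.reCLM _)]
  exact Complex.reCLM.integrable_comp (integrable_levyGenerator μ hν b _)

/-- Real and complex test functions give the same Stein identities. -/
theorem real_stein_iff_complexStein {d : ℕ} (μ : Measure (E d)) [IsFiniteMeasure μ]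
    {ν : Measure (E d)} [SFinite ν] (hν : ∫⁻ u, ENNReal.ofReal (min 1 (‖u‖ ^ 2)) ∂ν < ∞)
    (b : E d) :
    (∀ f : 𝓢(E d, ℝ), ∫ x, fderiv ℝ f x x ∂μ = ∫ x, levyGenerator b ν f x ∂μ)
      ↔ ComplexStein μ b ν := by
  have h1 : ∀ (L : ℂ →L[ℝ] ℝ) (g : 𝓢(E d, ℂ)),
      ∫ x, fderiv ℝ (fun x => L (g x)) x x ∂μ = L (∫ x, fderiv ℝ g x x ∂μ) := fun L g => by
    simp_rw [fderiv_clm_comp_apply]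
    exact L.integral_comp_comm (integrable_fderiv_self μ g)
  have h2 : ∀ (L : ℂ →L[ℝ] ℝ) (g : 𝓢(E d, ℂ)),
      ∫ x, levyGenerator b ν (fun x => L (g x)) x ∂μ = L (∫ x, levyGenerator b ν g x ∂μ) :=
    fun L g => by
      simp_rw [levyGenerator_clm_comp hν]
      exact L.integral_comp_comm (integrable_levyGenerator μ hν b g)
  constructor
  · intro h g
    have key : ∀ L : ℂ →L[ℝ] ℝ, L (∫ x, fderiv ℝ g x x ∂μ) = L (∫ x, levyGenerator b ν g x ∂μ) :=
      fun L => by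
        rw [← h1, ← h2]
        exact h (g.postcompCLM L)
    exact Complex.ext (key Complex.reCLM) (key Complex.imCLM)
  · intro h f
    have e1 := h1 Complex.reCLM (complexify f)
    have e2 := h2 Complex.reCLM (complexify f)
    rw [reCLM_complexify] at e1 e2
    rw [e1, e2, h]

theorem integrable_smul_sph {d : ℕ} (σ : Measure (Sph d)) [IsFiniteMeasure σ] {κ : Sph d → ℝ}
    (hκ : Continuous κ) : Integrable (fun x => κ x • (x : E d)) σ := by
  have hc : Continuous fun x : Sph d => κ x • (x : E d) := by fun_prop
  obtain ⟨C, hC⟩ := isCompact_univ.exists_bound_of_continuousOn hc.continuousOn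
  exact Integrable.of_bound hc.aestronglyMeasurable C (Eventually.of_forall fun x => hC x (mem_univ x))

theorem integral_inner_mul_sph {d : ℕ} (σ : Measure (Sph d)) [IsFiniteMeasure σ] {κ : Sph d → ℝ}
    (hκ : Continuous κ) (v : E d) :
    ∫ x, inner ℝ v (x : E d) * κ x ∂σ = inner ℝ v (∫ x, κ x • (x : E d) ∂σ) := by
  rw [← integral_inner (integrable_smul_sph σ hκ)]
  simp_rw [real_inner_smul_right, mul_comm]

theorem integrable_fderiv_apply {d : ℕ} (μ : Measure (E d)) [IsFiniteMeasure μ] (f : 𝓢(E d, ℝ))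
    (v : E d) : Integrable (fun x => fderiv ℝ f x v) μ := by
  obtain ⟨C, -, hC⟩ := f.decay 0 1
  refine (integrable_const (C * ‖v‖)).mono'
    ((continuous_fderiv_schwartz f).clm_apply continuous_const).aestronglyMeasurable
    (Eventually.of_forall fun x => ((fderiv ℝ f x).le_opNorm v).trans ?_)
  have := hC x
  rw [pow_zero, one_mul, norm_iteratedFDeriv_one] at this
  gcongr

/-- The right-hand side of the Stein identity is the expectation of the generator with drift
`b - m`. -/
theorem stein_rhs_eq_integral_levyGenerator {d : ℕ} {Ω : Type*} [MeasurableSpace Ω]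
    (P : Measure Ω) [IsProbabilityMeasure P] {X : Ω → E d} (hX : Measurable X)
    {ν : Measure (E d)} [SFinite ν] (hν : ∫⁻ u, ENNReal.ofReal (min 1 (‖u‖ ^ 2)) ∂ν < ∞)
    (b : E d) (σ : Measure (Sph d)) [IsFiniteMeasure σ] {κ : Sph d → ℝ} (hκ : Continuous κ)
    (f : 𝓢(E d, ℝ)) :
    ∫ ω, inner ℝ b (gradient f (X ω)) ∂P
        - ∫ ω, (∫ x, inner ℝ (gradient f (X ω)) (x : E d) * κ x ∂σ) ∂P
        + ∫ ω, (∫ u, (f (X ω + u) - f (X ω)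
            - if ‖u‖ ≤ 1 then inner ℝ (gradient f (X ω)) u else 0) ∂ν) ∂P
      = ∫ x, levyGenerator (b - ∫ x, κ x • (x : E d) ∂σ) ν f x ∂(P.map X) := by
  have hfin : IsProbabilityMeasure (P.map X) := Measure.isProbabilityMeasure_map hX.aemeasurable
  set m := ∫ x, κ x • (x : E d) ∂σ
  have hb : Integrable (fun ω => fderiv ℝ f (X ω) b) P :=
    (integrable_fderiv_apply (P.map X) f b).comp_measurable hX
  have hm : Integrable (fun ω => fderiv ℝ f (X ω) m) P :=
    (integrable_fderiv_apply (P.map X) f m).comp_measurable hX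
  have hG := integrable_levyGenerator_real (P.map X) hν (b - m) f
  have hG' : Integrable (fun ω => levyGenerator (b - m) ν f (X ω)) P := hG.comp_measurable hX
  have hJ : ∀ ω, ∫ u, (f (X ω + u) - f (X ω) - if ‖u‖ ≤ 1 then fderiv ℝ f (X ω) u else 0) ∂ν
      = levyGenerator (b - m) ν f (X ω) - (fderiv ℝ f (X ω) b - fderiv ℝ f (X ω) m) := fun ω => by
    rw [levyGenerator, map_sub]; ring
  simp_rw [integral_inner_mul_sph σ hκ, real_inner_comm (gradient f _) b, inner_gradient_left]
  simp_rw [hJ]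
  rw [integral_map hX.aemeasurable hG.aestronglyMeasurable,
    integral_sub (g := fun ω => fderiv ℝ f (X ω) b - fderiv ℝ f (X ω) m) hG' (hb.sub hm),
    integral_sub hb hm]
  ring

end SDStein

theorem mainTheorem5 {d : ℕ} (hd : 1 ≤ d)
    {Ω : Type*} [MeasurableSpace Ω] (P : Measure Ω) [IsProbabilityMeasure P]
    (X : Ω → SDStein.E d) (hX : Measurable X)
    (b : SDStein.E d) (ν : Measure (SDStein.E d)) (hν : SDStein.IsLevyMeasure ν)
    (σ : Measure (SDStein.Sph d)) [IsFiniteMeasure σ]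
    (k : SDStein.Sph d → ℝ → ℝ)
    (hν_polar : ν = SDStein.polarMeasure σ fun x => SDStein.radialMeasure (k x))
    (hk_nonneg : ∀ x, ∀ r, 0 < r → 0 ≤ k x r)
    (hk_anti : ∀ x, AntitoneOn (k x) (Ioi 0))
    (hk_cont : ∀ x, ContinuousOn (k x) (Ioi 0))
    (hk_cont_sphere : ∀ r, 0 < r → Continuous fun x => k x r)
    (hk_zero : ∀ x, Tendsto (fun ε => ε * k x ε) (𝓝[>] 0) (𝓝 (k x 1)))
    (hk_top : ∀ x, Tendsto (k x) atTop (𝓝 0))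
    (hk_int : ∫⁻ r in Ioi (0 : ℝ),
      ENNReal.ofReal (min 1 (r ^ 2) / r) * (⨆ x, ENNReal.ofReal (k x r)) < ∞)
    (hk_var : ∀ (y : ℕ → SDStein.Sph d) (x : SDStein.Sph d), Tendsto y atTop (𝓝 x) →
      ∀ a : ℝ, 0 < a →
        Tendsto (fun n => ⨆ R : ℝ, eVariationOn (fun r => k (y n) r - k x r) (Icc a R))
          atTop (𝓝 0))
    (νt : Measure (SDStein.E d))
    (hνt_polar : νt = SDStein.polarMeasure σ fun x => SDStein.negDiff (k x) (hk_anti x))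
    (hνt_int : ∫⁻ u, ENNReal.ofReal (min 1 (‖u‖ ^ 2)) ∂νt < ∞) :
    (∀ f : 𝓢(SDStein.E d, ℝ),
      ∫ ω, inner ℝ (X ω) (gradient f (X ω)) ∂P
        = ∫ ω, inner ℝ b (gradient f (X ω)) ∂P
          - ∫ ω, (∫ x, inner ℝ (gradient f (X ω)) (x : SDStein.E d) * k x 1 ∂σ) ∂P
          + ∫ ω, (∫ u, (f (X ω + u) - f (X ω)
              - if ‖u‖ ≤ 1 then inner ℝ (gradient f (X ω)) u else 0) ∂νt) ∂P)
      ↔ SDStein.IsSelfDecomposable (P.map X) b ν := by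
  have hs : SFinite νt := SDStein.sFinite_of_integrable_min_one_sq
    (hνt_polar ▸ SDStein.polarMeasure_negDiff_singleton_zero σ hk_anti hk_cont hk_cont_sphere)
    hνt_int
  have hP : IsProbabilityMeasure (P.map X) := Measure.isProbabilityMeasure_map hX.aemeasurable
  have hk1 : Continuous fun x => k x 1 := hk_cont_sphere 1 one_pos
  set m := ∫ x, k x 1 • (x : SDStein.E d) ∂σ
  have hmap : ν = (νt.prod (volume.restrict (Ioi (0 : ℝ)))).map
      fun p => Real.exp (-p.2) • p.1 := by
    rw [hν_polar, hνt_polar]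
    exact SDStein.polarMeasure_radialMeasure_eq_map σ hk_anti hk_cont hk_cont_sphere hk_top
  have hshift : ∀ ξ, ∫ u, (if 1 < ‖u‖ then inner ℝ ξ u / ‖u‖ else 0) ∂νt = inner ℝ m ξ := by
    intro ξ
    rw [hνt_polar] at hνt_int ⊢
    rw [SDStein.integral_inner_normalize_polarMeasure_negDiff σ hk_anti hk_cont hk_cont_sphere
      hk_top hk_nonneg hνt_int, SDStein.integral_inner_mul_sph σ hk1, real_inner_comm]
  have hexp := SDStein.levyExponent_eq_integral hν.2 hνt_int hmap hshift b
  have hflow := SDStein.hasDerivAt_of_eq_integral_exp_neg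
    (SDStein.continuous_levyExponent hνt_int (b - m)) (fun ξ => (hexp ξ).1) fun ξ => (hexp ξ).2
  have hiff := SDStein.complexStein_iff_charFun_eq (P.map X) hνt_int (b - m)
    (SDStein.continuous_levyExponent hν.2 b) (SDStein.levyExponent_zero_right b ν) hflow
  rw [← SDStein.real_stein_iff_complexStein (P.map X) hνt_int] at hiff
  have hlhs : ∀ f : 𝓢(SDStein.E d, ℝ), ∫ ω, inner ℝ (X ω) (gradient f (X ω)) ∂P
      = ∫ x, fderiv ℝ f x x ∂(P.map X) := by
    intro f
    rw [integral_map hX.aemeasurable (SDStein.integrable_fderiv_self _ f).aestronglyMeasurable]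
    simp_rw [real_inner_comm (gradient f _), inner_gradient_left]
  simp_rw [hlhs, SDStein.stein_rhs_eq_integral_levyGenerator P hX hνt_int b σ hk1]
  rw [hiff]
  -- The given σ and k witness the polar decomposition in one direction. In the other, only the
  -- characteristic function is used, so a decomposition of ν by other data is harmless.
  constructor
  · exact fun h => ⟨⟨Matrix.PosSemidef.zero, hν, h⟩, σ, k, inferInstance, hk_nonneg, hk_anti,
      fun x r hr => ((hk_cont x).continuousAt (Ioi_mem_nhds hr)).continuousWithinAt,
      fun r hr => (hk_cont_sphere r hr).measurable, hν_polar⟩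
  · exact fun h => h.1.charFun_eq
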